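/- A Pisot number is a real algebraic integer $\beta>1$ all of whose conjugates over $\mathbb{Q}$ other than $\beta$ have absolute value less than $1$ (rational integers greater than $1$ are included). A Salem number is a real algebraic integer $\beta>1$ all of whose conjugates over $\mathbb{Q}$ other than $\beta$ have absolute value at most $1$, with at least one conjugate of absolute value exactly $1$. Let $$\Theta=\{(y,z)\in\mathbb{R}^2 \mid y>0,\text{ or } y=0 \text{ and } z>0\},$$ and for $(y,z)\in\Theta$, real $R\ge 3$ and $0<X<1$ put $$\varphi(y,z;R)=\exp\left((\log R)^{1+y}(\log\log R)^z\right),\qquad \xi(y,z;X)=1+\sum_{m=3}^{\infty}X^{\lfloor\varphi(y,z;m)\rfloor}.$$ Theorem. Let $(y,z)\in\Theta$ and let $x$ be a real number greater than $1$. Then, for any Pisot or Salem number $\beta$, the two numbers $$\xi(y,z;\beta^{-1})\qquad\text{and}\qquad\sum_{m=0}^{\infty}\beta^{-\lfloor x^m\rfloor}$$ are algebraically independent over $\mathbb{Q}$. -/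

import Mathlib

namespace BetaExpansion

/-- A Pisot number: a real algebraic integer `β > 1` all of whose conjugates over `ℚ` (in `ℂ`)
other than `β` itself have absolute value less than `1`. Rational integers `> 1` are included. -/
def IsPisot (β : ℝ) : Prop :=
  IsIntegral ℤ β ∧ 1 < β ∧ ∀ w : ℂ, IsConjRoot ℚ (β : ℂ) w → w ≠ (β : ℂ) → ‖w‖ < 1

/-- A Salem number: a real algebraic integer `β > 1` all of whose conjugates over `ℚ` (in `ℂ`)
other than `β` itself have absolute value at most `1`, at least one of them having absolute
value exactly `1`. -/
def IsSalem (β : ℝ) : Prop :=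
  IsIntegral ℤ β ∧ 1 < β ∧
    (∀ w : ℂ, IsConjRoot ℚ (β : ℂ) w → w ≠ (β : ℂ) → ‖w‖ ≤ 1) ∧
    ∃ w : ℂ, IsConjRoot ℚ (β : ℂ) w ∧ ‖w‖ = 1

/-- The set `Θ` of the pairs `(y, z)` with `y > 0`, or `y = 0` and `z > 0`. -/
def Theta : Set (ℝ × ℝ) :=
  {p | 0 < p.1 ∨ (p.1 = 0 ∧ 0 < p.2)}

/-- `φ(y, z; R) = exp ((log R)^(1+y) (log log R)^z)`, used for `R ≥ 3`. -/
noncomputable def phi (y z R : ℝ) : ℝ :=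
  Real.exp (Real.log R ^ (1 + y) * Real.log (Real.log R) ^ z)

/-- `ξ(y, z; X) = 1 + ∑_{m ≥ 3} X^⌊φ(y, z; m)⌋`; the summation index is shifted by `3`. -/
noncomputable def xi (y z X : ℝ) : ℝ :=
  1 + ∑' m : ℕ, X ^ ⌊phi y z ((m + 3 : ℕ) : ℝ)⌋₊

end BetaExpansion

/-! A polynomial relation over `ℤ` yields a power series h vanishing at 1/β, namely a polynomial in
two lacunary series f and g with exponents ⌊φ(m)⌋ and ⌊x^m⌋. The coefficients of h grow
polynomially.

Arithmetic side. Suppose h has a run of G zero coefficients after index R, with R ≤ G². Then β^R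
times the truncation at R is an algebraic integer. Since h vanishes at 1/β, it equals minus β^R
times the tail, so it is at most G^O(1) β^(-G); its other conjugates are G^O(1), because the other
conjugates of β lie in the closed unit disc. For large G its norm is below 1, so it is zero
(`exists_truncation_eq_zero`). Comparing two such indices R ≤ R', the coefficients in between,
weighted by powers of β, sum to zero; if they are nonnegative, they all vanish
(`exists_coeff_eq_zero_of_runs`).

Combinatorial side. `exists_coeff_ne_zero_between_runs` contradicts this. Let f^(D+1) g^(E+1) be the
lexicographically leading monomial. Up to N = ⌊φ(q^(K+3))⌋ the series f has O(q^(K+3)) exponents and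
g only a power of log q, so by pigeonhole the monomials of lower degree in f all miss an interval of
length about N/q^((K+3)D+2). Yet exponents of f approximate integers from below with relative error
q^(-(K+1)), so those of f^(D+1) do so within N/q^((K+1)(D+1)). For K large this is smaller, and an
exponent of f^(D+1) falls into the gap. Take the last exponent r of the f^(D+1) g^l with l ≤ E
before a gap of those, and add an exponent t of g: only the leading monomial reaches r + t. Near it
h is a constant times a series with nonnegative coefficients, and pigeonhole supplies runs of zeros
on both sides. As φ outgrows every power, N dominates all powers of q involved, which secures R' ≤
G². -/

open PowerSeries Filter

/-! ### Series with polynomially growing coefficients and their evaluation -/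

/-- The integral power series whose coefficients grow at most polynomially. -/
def polyGrowth : Subring (PowerSeries ℤ) where
  carrier := {f | ∃ C k : ℕ, ∀ n, |coeff n f| ≤ (C : ℤ) * ((n : ℤ) + 1) ^ k}
  mul_mem' := by
    rintro f g ⟨C, k, hf⟩ ⟨C', k', hg⟩
    refine ⟨C * C', k + k' + 1, fun n => ?_⟩
    rw [coeff_mul]
    refine (Finset.abs_sum_le_sum_abs _ _).trans ?_
    calc ∑ p ∈ Finset.HasAntidiagonal.antidiagonal n, |coeff p.1 f * coeff p.2 g|
        ≤ ∑ p ∈ Finset.HasAntidiagonal.antidiagonal n,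
            ((C : ℤ) * ((n : ℤ) + 1) ^ k) * ((C' : ℤ) * ((n : ℤ) + 1) ^ k') := by
          refine Finset.sum_le_sum fun p hp => ?_
          have h := Finset.HasAntidiagonal.mem_antidiagonal.1 hp
          rw [abs_mul]
          have h1 : (p.1 : ℤ) ≤ n := by omega
          have h2 : (p.2 : ℤ) ≤ n := by omega
          have e1 : |coeff p.1 f| ≤ (C : ℤ) * ((n : ℤ) + 1) ^ k :=
            (hf p.1).trans (by gcongr)
          have e2 : |coeff p.2 g| ≤ (C' : ℤ) * ((n : ℤ) + 1) ^ k' :=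
            (hg p.2).trans (by gcongr)
          exact mul_le_mul e1 e2 (abs_nonneg _) (by positivity)
      _ = _ := by
          rw [Finset.sum_const, Finset.Nat.card_antidiagonal]
          push_cast
          simp only [nsmul_eq_mul]
          push_cast
          ring
  one_mem' := by
    refine ⟨1, 0, fun n => ?_⟩
    rw [coeff_one]
    split_ifs <;> simp
  add_mem' := by
    rintro f g ⟨C, k, hf⟩ ⟨C', k', hg⟩
    refine ⟨C + C', k + k', fun n => ?_⟩
    rw [map_add]
    have hn : (1 : ℤ) ≤ (n : ℤ) + 1 := by omega
    have e1 : |coeff n f| ≤ (C : ℤ) * ((n : ℤ) + 1) ^ (k + k') :=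
      (hf n).trans (mul_le_mul_of_nonneg_left (pow_le_pow_right₀ hn (by omega)) (by positivity))
    have e2 : |coeff n g| ≤ (C' : ℤ) * ((n : ℤ) + 1) ^ (k + k') :=
      (hg n).trans (mul_le_mul_of_nonneg_left (pow_le_pow_right₀ hn (by omega)) (by positivity))
    have := abs_add_le (coeff n f) (coeff n g)
    push_cast
    linarith [add_mul (C : ℤ) C' (((n : ℤ) + 1) ^ (k + k'))]
  zero_mem' := ⟨0, 0, fun n => by simp⟩
  neg_mem' := by
    rintro f ⟨C, k, hf⟩
    exact ⟨C, k, fun n => by rw [map_neg, abs_neg]; exact hf n⟩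

theorem summable_succ_pow_mul_geometric (k : ℕ) {r : ℝ} (h0 : 0 < r) (h1 : r < 1) :
    Summable fun n : ℕ => ((n : ℝ) + 1) ^ k * r ^ n := by
  have h := (summable_pow_mul_geometric_of_norm_lt_one k (r := r)
    (by rwa [Real.norm_of_nonneg h0.le]))
  have h2 := ((summable_nat_add_iff 1).2 h).mul_right r⁻¹
  refine h2.congr fun n => ?_
  push_cast
  rw [pow_succ r, ← mul_assoc, mul_assoc _ r, mul_inv_cancel₀ h0.ne', mul_one]

theorem summable_norm_coeff_mul_pow {f : PowerSeries ℤ} (hf : f ∈ polyGrowth) {r : ℝ}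
    (h0 : 0 < r) (h1 : r < 1) : Summable fun n : ℕ => ‖((coeff n f : ℤ) : ℝ) * r ^ n‖ := by
  obtain ⟨C, k, h⟩ := hf
  refine Summable.of_nonneg_of_le (fun n => norm_nonneg _) (fun n => ?_)
    ((summable_succ_pow_mul_geometric k h0 h1).mul_left (C : ℝ))
  rw [norm_mul, Real.norm_eq_abs, norm_pow, Real.norm_of_nonneg h0.le, ← mul_assoc]
  gcongr
  exact_mod_cast h n

/-- Evaluation of a power series with polynomially growing coefficients at `r ∈ (0, 1)`. -/
noncomputable def evalAt {r : ℝ} (h0 : 0 < r) (h1 : r < 1) : polyGrowth →+* ℝ where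
  toFun f := ∑' n : ℕ, ((coeff n f.1 : ℤ) : ℝ) * r ^ n
  map_one' := by
    rw [tsum_eq_single 0]
    · simp
    · intro n hn
      simp [coeff_one, hn]
  map_zero' := by simp
  map_add' f g := by
    rw [← (summable_norm_coeff_mul_pow f.2 h0 h1).of_norm.tsum_add
      (summable_norm_coeff_mul_pow g.2 h0 h1).of_norm]
    refine tsum_congr fun n => ?_
    simp [add_mul]
  map_mul' f g := by
    rw [tsum_mul_tsum_eq_tsum_sum_antidiagonal_of_summable_norm
      (summable_norm_coeff_mul_pow f.2 h0 h1) (summable_norm_coeff_mul_pow g.2 h0 h1)]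
    refine tsum_congr fun n => ?_
    rw [Subring.coe_mul, coeff_mul]
    push_cast
    rw [Finset.sum_mul]
    refine Finset.sum_congr rfl fun p hp => ?_
    rw [← Finset.HasAntidiagonal.mem_antidiagonal.1 hp, pow_add]
    ring

/-- The series `1 + ∑ i, X ^ s i` for a sequence `s` of exponents with finite fibres. -/
noncomputable def onePlusSeries (s : ℕ → ℕ) : PowerSeries ℤ :=
  1 + PowerSeries.mk fun n => (Nat.card {i // s i = n} : ℤ)

theorem evalAt_onePlusSeries {s : ℕ → ℕ} (hs : onePlusSeries s ∈ polyGrowth)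
    (hfin : ∀ n, {i | s i = n}.Finite) {r : ℝ} (h0 : 0 < r) (h1 : r < 1) :
    evalAt h0 h1 ⟨onePlusSeries s, hs⟩ = 1 + ∑' i, r ^ s i := by
  have hs' : (PowerSeries.mk fun n => (Nat.card {i // s i = n} : ℤ)) ∈ polyGrowth := by
    have := polyGrowth.sub_mem hs polyGrowth.one_mem
    rwa [onePlusSeries, add_sub_cancel_left] at this
  have e : (⟨onePlusSeries s, hs⟩ : polyGrowth) = 1 + ⟨_, hs'⟩ := rfl
  rw [e, map_add, map_one]
  congr 1
  have hsum := summable_norm_coeff_mul_pow hs' h0 h1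
  simp only [coeff_mk] at hsum
  have hfib : ∀ n, ∑' b : {i // s i = n}, r ^ s b.1 = ((Nat.card {i // s i = n} : ℤ) : ℝ) * r ^ n := by
    intro n
    have : Finite {i // s i = n} := hfin n
    have := Fintype.ofFinite {i // s i = n}
    rw [tsum_fintype, Finset.sum_congr rfl (fun b _ => by rw [b.2])]
    simp [Nat.card_eq_fintype_card]
  have hsm : Summable fun p : Σ n, {i // s i = n} => r ^ s p.2.1 := by
    rw [summable_sigma_of_nonneg (fun _ => by positivity)]
    refine ⟨fun n => ?_, ?_⟩
    · have : Finite {i // s i = n} := hfin n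
      exact Summable.of_finite
    · simp only [hfib]
      exact hsum.of_norm
  change ∑' n, ((coeff n (PowerSeries.mk fun n => (Nat.card {i // s i = n} : ℤ)) : ℤ) : ℝ) * r ^ n = _
  simp only [coeff_mk, ← hfib]
  rw [← hsm.tsum_sigma, ← (Equiv.sigmaFiberEquiv s).tsum_eq]
  rfl

/-! ### Liouville bound and vanishing truncations -/

/-- The norm of a nonzero algebraic integer is a nonzero rational integer, and `S` bounds its factor
at every embedding other than `τ`. -/
theorem one_le_norm_aeval_mul_pow {K : Type*} [Field K] [Algebra ℚ K] [FiniteDimensional ℚ K]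
    {g : K} (hg : IsIntegral ℤ g) (τ : K →ₐ[ℚ] ℂ)
    (hτ : ∀ σ : K →ₐ[ℚ] ℂ, σ ≠ τ → ‖σ g‖ ≤ 1) {q : Polynomial ℤ} {S : ℝ}
    (hq : ∀ w : ℂ, ‖w‖ ≤ 1 → ‖Polynomial.aeval w q‖ ≤ S) (hne : Polynomial.aeval (τ g) q ≠ 0) :
    1 ≤ ‖Polynomial.aeval (τ g) q‖ * S ^ (Fintype.card (K →ₐ[ℚ] ℂ) - 1) := by
  classical
  have : CharZero K := algebraRat.charZero K
  have hsig : ∀ σ : K →ₐ[ℚ] ℂ, σ (Polynomial.aeval g q) = Polynomial.aeval (σ g) q := fun σ =>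
    (Polynomial.aeval_algHom_apply (σ.restrictScalars ℤ) g q).symm
  have hx0 : Polynomial.aeval g q ≠ 0 := by
    intro h
    rw [← hsig, h, map_zero] at hne
    exact hne rfl
  have hxint : IsIntegral ℤ (Polynomial.aeval g q) :=
    adjoin_le_integralClosure hg (Polynomial.aeval_mem_adjoin_singleton ℤ g)
  obtain ⟨z, hz⟩ := IsIntegrallyClosed.isIntegral_iff.1 (Algebra.isIntegral_norm ℚ hxint)
  have hz0 : z ≠ 0 := by
    rintro rfl
    rw [map_zero] at hz
    exact hx0 (Algebra.norm_eq_zero_iff.1 hz.symm)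
  have hnorm : (1 : ℝ) ≤ ‖algebraMap ℚ ℂ (Algebra.norm ℚ (Polynomial.aeval g q))‖ := by
    rw [← hz]
    simp only [eq_intCast, map_intCast, Complex.norm_intCast]
    exact_mod_cast Int.one_le_abs hz0
  rw [Algebra.norm_eq_prod_embeddings, norm_prod,
    ← Finset.mul_prod_erase _ _ (Finset.mem_univ τ), hsig] at hnorm
  refine hnorm.trans (mul_le_mul_of_nonneg_left ?_ (norm_nonneg _))
  rw [← Finset.card_univ, ← Finset.card_erase_of_mem (Finset.mem_univ τ), ← Finset.prod_const]
  refine Finset.prod_le_prod (fun _ _ => norm_nonneg _) fun σ hσ => ?_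
  rw [hsig]
  exact hq _ (hτ σ (Finset.ne_of_mem_erase hσ))

/-- A Liouville-type bound at an algebraic integer all of whose other conjugates lie in the
closed unit disc. -/
theorem exists_one_le_abs_aeval_mul_pow {β : ℝ} (hint : IsIntegral ℤ β)
    (hconj : ∀ w : ℂ, IsConjRoot ℚ (β : ℂ) w → w ≠ (β : ℂ) → ‖w‖ ≤ 1) :
    ∃ d : ℕ, ∀ (q : Polynomial ℤ) (S : ℝ),
      (∀ w : ℂ, ‖w‖ ≤ 1 → ‖Polynomial.aeval w q‖ ≤ S) → Polynomial.aeval β q ≠ 0 →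
      1 ≤ |Polynomial.aeval β q| * S ^ d := by
  have hintC : IsIntegral ℤ (β : ℂ) := hint.map (Complex.ofRealAm.restrictScalars ℤ)
  have hintQ : IsIntegral ℚ (β : ℂ) := hintC.tower_top
  let K := IntermediateField.adjoin ℚ {(β : ℂ)}
  let _ : Algebra ℚ K := K.algebra'
  have : FiniteDimensional ℚ K := IntermediateField.adjoin.finiteDimensional hintQ
  let g : K := IntermediateField.AdjoinSimple.gen ℚ (β : ℂ)
  let τ : K →ₐ[ℚ] ℂ := K.val
  have hg : τ g = (β : ℂ) := IntermediateField.AdjoinSimple.coe_gen ℚ (β : ℂ)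
  have hgint : IsIntegral ℤ g := by
    have h : IsIntegral ℤ (τ g) := by rw [hg]; exact hintC
    exact (isIntegral_algHom_iff (τ.restrictScalars ℤ) τ.injective).1 h
  have hτ : ∀ σ : K →ₐ[ℚ] ℂ, σ ≠ τ → ‖σ g‖ ≤ 1 := by
    intro σ hσ
    refine hconj _ ?_ fun h => hσ ?_
    · rw [isConjRoot_def, minpoly.algHom_eq σ σ.injective, ← hg, minpoly.algHom_eq τ τ.injective]
    · refine (IntermediateField.adjoin.powerBasis hintQ).algHom_ext ?_
      rw [IntermediateField.adjoin.powerBasis_gen]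
      exact h.trans hg.symm
  have hval : ∀ q : Polynomial ℤ,
      Polynomial.aeval (τ g) q = ((Polynomial.aeval β q : ℝ) : ℂ) := by
    intro q
    rw [hg]
    exact Polynomial.aeval_algHom_apply (Complex.ofRealAm.restrictScalars ℤ) β q
  refine ⟨Fintype.card (K →ₐ[ℚ] ℂ) - 1, fun q S hq hne => ?_⟩
  have := one_le_norm_aeval_mul_pow hgint τ hτ hq (by
    rw [hval]
    exact_mod_cast hne)
  rwa [hval, Complex.norm_real, Real.norm_eq_abs] at this

/-- The condition R ≤ G² turns every polynomial factor in R into one in G, so the factor r^G from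
the tail beats the Liouville bound. -/
theorem exists_truncation_eq_zero {β : ℝ} (hint : IsIntegral ℤ β) (hβ : 1 < β)
    (hconj : ∀ w : ℂ, IsConjRoot ℚ (β : ℂ) w → w ≠ (β : ℂ) → ‖w‖ ≤ 1)
    (h0 : 0 < β⁻¹) (h1 : β⁻¹ < 1) {h : polyGrowth} (hh : evalAt h0 h1 h = 0) :
    ∃ G₀ : ℕ, ∀ G R : ℕ, G₀ ≤ G → R ≤ G ^ 2 →
      (∀ n, R < n → n ≤ R + G → coeff n h.1 = 0) →
      ∑ n ∈ Finset.range (R + 1), ((coeff n h.1 : ℤ) : ℝ) * β ^ (R - n) = 0 := by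
  obtain ⟨d, hd⟩ := exists_one_le_abs_aeval_mul_pow hint hconj
  obtain ⟨C, k, hC⟩ := h.2
  have hCr : ∀ n, |((coeff n h.1 : ℤ) : ℝ)| ≤ C * ((n : ℝ) + 1) ^ k := fun n => by
    exact_mod_cast hC n
  set r := β⁻¹ with hr
  set σ : ℝ := ∑' j : ℕ, ((j : ℝ) + 1) ^ k * r ^ j with hσ
  have hσs := summable_succ_pow_mul_geometric k h0 h1
  have hσ0 : 0 ≤ σ := tsum_nonneg fun j => by positivity
  -- The part 2k comes from the tail, the part 2(k+1)d from S^d.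
  set A := 2 * k + 2 * (k + 1) * d with hA
  set C1 : ℝ := C * 2 ^ k * σ * (C + 1) ^ d with hC1
  have hlim : Filter.Tendsto (fun G : ℕ => C1 * (((G : ℝ) + 1) ^ A * r ^ G)) Filter.atTop
      (nhds 0) := by
    simpa using (summable_succ_pow_mul_geometric A h0 h1).tendsto_atTop_zero.const_mul C1
  obtain ⟨G₀, hG₀⟩ := Filter.eventually_atTop.1 (hlim.eventually_lt_const one_pos)
  refine ⟨G₀, fun G R hG hR hz => ?_⟩
  by_contra hne
  -- Reversed truncation: its value at β is β^R times the partial sum at β⁻¹, and on the closed unit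
  -- disc it is bounded by the sum of the absolute values of the coefficients.
  set q : Polynomial ℤ := ∑ n ∈ Finset.range (R + 1),
    Polynomial.C (coeff n h.1) * Polynomial.X ^ (R - n) with hq
  have haev : ∀ {E : Type} [CommRing E] (w : E), Polynomial.aeval w q =
      ∑ n ∈ Finset.range (R + 1), ((coeff n h.1 : ℤ) : E) * w ^ (R - n) := by
    intro E _ w
    simp [hq, map_sum]
  have hRr : (R : ℝ) + 1 ≤ ((G : ℝ) + 1) ^ 2 := by
    have : (R : ℝ) ≤ (G : ℝ) ^ 2 := by exact_mod_cast hR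
    nlinarith [(Nat.cast_nonneg G : (0 : ℝ) ≤ G)]
  set S : ℝ := (C + 1) * ((G : ℝ) + 1) ^ (2 * (k + 1)) with hS
  have hSw : ∀ w : ℂ, ‖w‖ ≤ 1 → ‖Polynomial.aeval w q‖ ≤ S := by
    intro w hw
    rw [haev]
    calc ‖∑ n ∈ Finset.range (R + 1), ((coeff n h.1 : ℤ) : ℂ) * w ^ (R - n)‖
        ≤ ∑ n ∈ Finset.range (R + 1), (C + 1) * ((R : ℝ) + 1) ^ k := by
          refine norm_sum_le_of_le _ fun n hn => ?_
          rw [norm_mul, norm_pow, Complex.norm_intCast]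
          have hnR : (n : ℝ) ≤ R := by
            exact_mod_cast Nat.lt_succ_iff.1 (Finset.mem_range.1 hn)
          calc _ ≤ |((coeff n h.1 : ℤ) : ℝ)| * 1 := by
                gcongr
                exact pow_le_one₀ (norm_nonneg _) hw
            _ ≤ C * ((n : ℝ) + 1) ^ k := by rw [mul_one]; exact hCr n
            _ ≤ (C + 1) * ((R : ℝ) + 1) ^ k := by gcongr; linarith
      _ = (C + 1) * ((R : ℝ) + 1) ^ (k + 1) := by
          rw [Finset.sum_const, Finset.card_range, nsmul_eq_mul]
          push_cast
          ring
      _ ≤ S := by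
          rw [hS, pow_mul]
          gcongr
  have hb := hd q S hSw (by rw [haev]; exact hne)
  have hqb : |Polynomial.aeval β q| ≤ C * 2 ^ k * ((G : ℝ) + 1) ^ (2 * k) * r ^ G * σ := by
    have hs := summable_norm_coeff_mul_pow h.2 h0 h1
    have hh' : ∑' n : ℕ, ((coeff n h.1 : ℤ) : ℝ) * r ^ n = 0 := hh
    have hsplit := hs.of_norm.sum_add_tsum_nat_add (R + 1 + G)
    rw [hh', Finset.sum_range_add] at hsplit
    have hz' : ∑ x ∈ Finset.range G, ((coeff (R + 1 + x) h.1 : ℤ) : ℝ) * r ^ (R + 1 + x) = 0 := by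
      refine Finset.sum_eq_zero fun x hx => ?_
      have := Finset.mem_range.1 hx
      rw [hz _ (by omega) (by omega)]
      simp
    rw [hz', add_zero] at hsplit
    have hβ0 : β ≠ 0 := by positivity
    have e1 : Polynomial.aeval β q =
        β ^ R * ∑ n ∈ Finset.range (R + 1), ((coeff n h.1 : ℤ) : ℝ) * r ^ n := by
      rw [haev, Finset.mul_sum]
      refine Finset.sum_congr rfl fun n hn => ?_
      have hnR : n ≤ R := Nat.lt_succ_iff.1 (Finset.mem_range.1 hn)
      rw [pow_sub₀ _ hβ0 hnR, hr, inv_pow]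
      ring
    rw [e1, eq_neg_of_add_eq_zero_left hsplit, mul_neg, abs_neg, abs_mul, abs_of_pos (by positivity),
      ← Real.norm_eq_abs]
    have hterm : ∀ j : ℕ, ‖((coeff (j + (R + 1 + G)) h.1 : ℤ) : ℝ) * r ^ (j + (R + 1 + G))‖ ≤
        (C * 2 ^ k * ((G : ℝ) + 1) ^ (2 * k) * r ^ (R + G)) * (((j : ℝ) + 1) ^ k * r ^ j) := by
      intro j
      rw [norm_mul, norm_pow, Real.norm_of_nonneg h0.le, Real.norm_eq_abs]
      have hj : (((j + (R + 1 + G) : ℕ) : ℝ) + 1) ≤ 2 * ((G : ℝ) + 1) ^ 2 * ((j : ℝ) + 1) := by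
        push_cast
        have hG0 := (Nat.cast_nonneg G : (0 : ℝ) ≤ G)
        have hj0 := (Nat.cast_nonneg j : (0 : ℝ) ≤ j)
        nlinarith [mul_nonneg hG0 hj0, mul_nonneg hj0 (sq_nonneg (G : ℝ))]
      calc _ ≤ (C * (2 * ((G : ℝ) + 1) ^ 2 * ((j : ℝ) + 1)) ^ k) * r ^ (j + (R + G)) := by
            refine mul_le_mul ((hCr _).trans (by gcongr)) ?_ (by positivity) (by positivity)
            exact pow_le_pow_of_le_one h0.le h1.le (by omega)
        _ = _ := by
            rw [mul_pow, mul_pow, ← pow_mul, pow_add r j]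
            ring
    have htb := tsum_of_norm_bounded (hσs.hasSum.mul_left
      (C * 2 ^ k * ((G : ℝ) + 1) ^ (2 * k) * r ^ (R + G))) hterm
    calc _ ≤ β ^ R * ((C * 2 ^ k * ((G : ℝ) + 1) ^ (2 * k) * r ^ (R + G)) * σ) := by
          gcongr
      _ = (β ^ R * r ^ R) * (C * 2 ^ k * ((G : ℝ) + 1) ^ (2 * k) * r ^ G * σ) := by
          rw [pow_add]; ring
      _ = _ := by rw [← mul_pow, hr, mul_inv_cancel₀ hβ0, one_pow, one_mul]
  have : (1 : ℝ) ≤ C1 * (((G : ℝ) + 1) ^ A * r ^ G) := by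
    refine hb.trans ?_
    calc _ ≤ (C * 2 ^ k * ((G : ℝ) + 1) ^ (2 * k) * r ^ G * σ) * S ^ d := by gcongr
      _ = _ := by
        rw [hC1, hA, hS, mul_pow, ← pow_mul, pow_add]
        ring
  linarith [hG₀ G hG]

/-- If the value of the series vanishes, a nonzero coefficient cannot lie between two runs of
zero coefficients when all the coefficients between these runs are nonnegative. -/
theorem exists_coeff_eq_zero_of_runs {β : ℝ} (hint : IsIntegral ℤ β) (hβ : 1 < β)
    (hconj : ∀ w : ℂ, IsConjRoot ℚ (β : ℂ) w → w ≠ (β : ℂ) → ‖w‖ ≤ 1)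
    (h0 : 0 < β⁻¹) (h1 : β⁻¹ < 1) {h : polyGrowth} (hh : evalAt h0 h1 h = 0) :
    ∃ G₀ : ℕ, ∀ G R R' : ℕ, G₀ ≤ G → R ≤ R' → R' ≤ G ^ 2 →
      (∀ n, R < n → n ≤ R + G → coeff n h.1 = 0) →
      (∀ n, R' < n → n ≤ R' + G → coeff n h.1 = 0) →
      (∀ n, R < n → n ≤ R' → 0 ≤ coeff n h.1) →
      ∀ n, R < n → n ≤ R' → coeff n h.1 = 0 := by
  obtain ⟨G₀, H⟩ := exists_truncation_eq_zero hint hβ hconj h0 h1 hh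
  refine ⟨G₀, fun G R R' hG hRR hR' hz hz' hpos n hn hn' => ?_⟩
  have e1 := H G R hG (hRR.trans hR') hz
  have e2 := H G R' hG hR' hz'
  have hsplit := Finset.sum_range_add_sum_Ico
    (fun n => ((coeff n h.1 : ℤ) : ℝ) * β ^ (R' - n)) (show R + 1 ≤ R' + 1 by omega)
  -- The truncation at R still vanishes after rescaling by β^(R'-R), so only the terms between R and
  -- R' survive.
  have e3 : ∑ n ∈ Finset.range (R + 1), ((coeff n h.1 : ℤ) : ℝ) * β ^ (R' - n) = 0 := by
    rw [← mul_zero (β ^ (R' - R)), ← e1, Finset.mul_sum]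
    refine Finset.sum_congr rfl fun m hm => ?_
    have := Finset.mem_range.1 hm
    rw [show R' - m = (R' - R) + (R - m) by omega, pow_add]
    ring
  rw [e3, e2, zero_add] at hsplit
  have hnn : ∀ m ∈ Finset.Ico (R + 1) (R' + 1), 0 ≤ ((coeff m h.1 : ℤ) : ℝ) * β ^ (R' - m) := by
    intro m hm
    have := Finset.mem_Ico.1 hm
    have := hpos m (by omega) (by omega)
    positivity
  have := (Finset.sum_eq_zero_iff_of_nonneg hnn).1 hsplit n (Finset.mem_Ico.2 ⟨by omega, by omega⟩)
  have hb : β ^ (R' - n) ≠ 0 := by positivity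
  exact_mod_cast (mul_eq_zero.1 this).resolve_right hb

/-! ### Supports of products and powers -/

/-- The number of exponents at most `N` in the support of a power series. -/
noncomputable def suppCount (F : PowerSeries ℤ) (N : ℕ) : ℕ :=
  ((Finset.range (N + 1)).filter fun n => coeff n F ≠ 0).card

theorem exists_coeff_ne_zero_of_coeff_mul_ne_zero {F G : PowerSeries ℤ} {n : ℕ}
    (h : coeff n (F * G) ≠ 0) : ∃ i j, i + j = n ∧ coeff i F ≠ 0 ∧ coeff j G ≠ 0 := by
  rw [coeff_mul] at h
  obtain ⟨p, hp, hne⟩ := Finset.exists_ne_zero_of_sum_ne_zero h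
  exact ⟨p.1, p.2, Finset.HasAntidiagonal.mem_antidiagonal.1 hp, left_ne_zero_of_mul hne,
    right_ne_zero_of_mul hne⟩

theorem suppCount_mul_le (F G : PowerSeries ℤ) (N : ℕ) :
    suppCount (F * G) N ≤ suppCount F N * suppCount G N := by
  classical
  rw [suppCount, suppCount, suppCount, ← Finset.card_product]
  refine le_trans (Finset.card_le_card fun n hn => ?_)
    (Finset.card_image_le (f := fun p : ℕ × ℕ => p.1 + p.2))
  obtain ⟨hn1, hn2⟩ := Finset.mem_filter.1 hn
  obtain ⟨i, j, rfl, hi, hj⟩ := exists_coeff_ne_zero_of_coeff_mul_ne_zero hn2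
  have := Finset.mem_range.1 hn1
  refine Finset.mem_image.2 ⟨(i, j), Finset.mem_product.2 ⟨?_, ?_⟩, rfl⟩ <;>
    refine Finset.mem_filter.2 ⟨Finset.mem_range.2 (by dsimp only; omega), by assumption⟩

theorem suppCount_pow_le (F : PowerSeries ℤ) (N k : ℕ) :
    suppCount (F ^ k) N ≤ suppCount F N ^ k := by
  induction k with
  | zero =>
    rw [pow_zero, pow_zero, suppCount, Finset.card_le_one]
    intro a ha b hb
    have h1 := (Finset.mem_filter.1 ha).2
    have h2 := (Finset.mem_filter.1 hb).2
    rw [coeff_one] at h1 h2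
    simp only [ne_eq, ite_eq_right_iff, one_ne_zero, imp_false, not_not] at h1 h2
    rw [h1, h2]
  | succ k ih =>
    rw [pow_succ, pow_succ]
    exact (suppCount_mul_le _ _ _).trans (Nat.mul_le_mul_right _ ih)

theorem one_le_suppCount {F : PowerSeries ℤ} (h : 0 < coeff 0 F) (N : ℕ) :
    1 ≤ suppCount F N :=
  Finset.card_pos.2 ⟨0, Finset.mem_filter.2 ⟨by simp, h.ne'⟩⟩

theorem coeff_mul_nonneg {F G : PowerSeries ℤ} (hF : ∀ n, 0 ≤ coeff n F)
    (hG : ∀ n, 0 ≤ coeff n G) (n : ℕ) : 0 ≤ coeff n (F * G) := by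
  rw [coeff_mul]
  exact Finset.sum_nonneg fun p _ => mul_nonneg (hF _) (hG _)

theorem coeff_pow_nonneg {F : PowerSeries ℤ} (hF : ∀ n, 0 ≤ coeff n F) (k n : ℕ) :
    0 ≤ coeff n (F ^ k) := by
  induction k generalizing n with
  | zero =>
    rw [pow_zero, coeff_one]
    split_ifs <;> simp
  | succ k ih =>
    rw [pow_succ]
    exact coeff_mul_nonneg ih hF n

theorem coeff_add_mul_pos {F G : PowerSeries ℤ} (hF : ∀ n, 0 ≤ coeff n F)
    (hG : ∀ n, 0 ≤ coeff n G) {i j : ℕ} (hi : 0 < coeff i F) (hj : 0 < coeff j G) :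
    0 < coeff (i + j) (F * G) := by
  rw [coeff_mul]
  refine (mul_pos hi hj).trans_le ?_
  exact Finset.single_le_sum (f := fun p : ℕ × ℕ => coeff p.1 F * coeff p.2 G)
    (fun p _ => mul_nonneg (hF _) (hG _))
    (show (i, j) ∈ _ from Finset.HasAntidiagonal.mem_antidiagonal.2 rfl)

/-- The constant term of `G` preserves every exponent of `F`, so supports only grow with `k`. This
is what the leading 1 in both series is for. -/
theorem coeff_mul_pow_pos {F G : PowerSeries ℤ} (hF : ∀ n, 0 ≤ coeff n F)
    (hG : ∀ n, 0 ≤ coeff n G) (hG0 : 0 < coeff 0 G) {n : ℕ} (hn : 0 < coeff n F) (k : ℕ) :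
    0 < coeff n (F * G ^ k) := by
  induction k with
  | zero => simpa using hn
  | succ k ih =>
    rw [pow_succ, ← mul_assoc]
    exact coeff_add_mul_pos (coeff_mul_nonneg hF (coeff_pow_nonneg hG k)) hG (j := 0) ih hG0

/-! ### Gaps in supports and isolated leading coefficients -/

/-- Pigeonhole: an interval of length `T` contains a subinterval of length `T / X` that misses a
given set of fewer than `X` elements. -/
theorem exists_block_disjoint (A : Finset ℕ) {X : ℕ} (hA : A.card < X) (p T : ℕ) :
    ∃ p', p ≤ p' ∧ p' + T / X ≤ p + T ∧ ∀ n, p' < n → n ≤ p' + T / X → n ∉ A := by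
  set L := T / X with hL
  have hXL : X * L ≤ T := Nat.mul_div_le T X
  by_contra! H
  -- Otherwise each of `X` consecutive disjoint blocks of length `L` contains an element of `A`.
  have H' : ∀ j, j < X → ∃ n ∈ A, p + j * L < n ∧ n ≤ p + (j + 1) * L := by
    intro j hj
    have h1 : (j + 1) * L ≤ X * L := Nat.mul_le_mul_right L hj
    rw [Nat.succ_mul] at h1
    obtain ⟨n, a, b, c⟩ := H (p + j * L) (by omega) (by omega)
    exact ⟨n, c, a, by rw [Nat.succ_mul]; omega⟩
  choose! φ h1 h2 h3 using H'
  obtain ⟨i, hi, j, hj, hij, he⟩ := Finset.exists_ne_map_eq_of_card_lt_of_maps_to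
    (s := Finset.range X) (t := A) (f := φ) (by simpa using hA)
    (fun j hj => h1 j (Finset.mem_range.1 hj))
  have key : ∀ i j, i < X → j < X → i < j → φ i ≠ φ j := by
    intro i j hi hj hij he
    have a := h3 i hi
    have b := h2 j hj
    have : (i + 1) * L ≤ j * L := Nat.mul_le_mul_right L hij
    omega
  rw [Finset.mem_range] at hi hj
  rcases lt_or_gt_of_ne hij with h | h
  · exact key i j hi hj h he
  · exact key j i hj hi h he.symm

/-- Greedy approximation of integers from below by exponents of `f ^ k`. -/
theorem exists_coeff_pow_pos_near {f : PowerSeries ℤ} (hf : ∀ n, 0 ≤ coeff n f)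
    (hf0 : 0 < coeff 0 f) {N Q Y D : ℕ} (hQ : 1 ≤ Q) (hY : Q ^ D ≤ Y)
    (hstep : ∀ R ≤ N, N ≤ R * Y → ∃ s ≤ R, 0 < coeff s f ∧ (R - s) * Q ≤ R)
    {R : ℕ} (hR : R ≤ N) {k : ℕ} (hk : k ≤ D) :
    ∃ n ≤ R, 0 < coeff n (f ^ k) ∧ (R - n) * Q ^ k ≤ N := by
  induction k with
  | zero => exact ⟨0, by omega, by simp, by simpa using hR⟩
  | succ k ih =>
    obtain ⟨n, hn, hpos, hrem⟩ := ih (by omega)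
    by_cases hc : (R - n) * Q ^ (k + 1) ≤ N
    -- The remainder is already small enough: the extra factor f contributes the exponent 0.
    · refine ⟨n, hn, ?_, hc⟩
      have := coeff_mul_pow_pos (coeff_pow_nonneg hf k) hf hf0 hpos 1
      rwa [pow_one, ← pow_succ] at this
    · have hQk : Q ^ (k + 1) ≤ Y := (Nat.pow_le_pow_right hQ hk).trans hY
      obtain ⟨s, hs, hspos, hsrem⟩ := hstep (R - n) (by omega)
        ((not_le.1 hc).le.trans (Nat.mul_le_mul_left _ hQk))
      refine ⟨n + s, by omega, ?_, ?_⟩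
      · rw [pow_succ]
        exact coeff_add_mul_pos (coeff_pow_nonneg hf k) hf hpos hspos
      · calc (R - (n + s)) * Q ^ (k + 1) = (R - n - s) * Q * Q ^ k := by
              rw [Nat.sub_sub, pow_succ]; ring
          _ ≤ (R - n) * Q ^ k := Nat.mul_le_mul_right _ hsrem
          _ ≤ N := hrem

open Classical in
/-- The exponents at most `N` in the support of some `f ^ k * g ^ l` with `(k, l) ∈ J`. -/
noncomputable def monomialSupport (f g : PowerSeries ℤ) (J : Finset (ℕ × ℕ)) (N : ℕ) : Finset ℕ :=
  (Finset.range (N + 1)).filter fun n => ∃ p ∈ J, coeff n (f ^ p.1 * g ^ p.2) ≠ 0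

theorem mem_monomialSupport {f g : PowerSeries ℤ} {J : Finset (ℕ × ℕ)} {N n : ℕ} :
    n ∈ monomialSupport f g J N ↔ n ≤ N ∧ ∃ p ∈ J, coeff n (f ^ p.1 * g ^ p.2) ≠ 0 := by
  rw [monomialSupport, Finset.mem_filter, Finset.mem_range, Nat.lt_succ_iff]

/-- Each monomial has at most (2q^K)^k · q exponents, the last q covering the power of g. One more q
absorbs |J| · 2^k, whence the +2. -/
theorem card_monomialSupport_lt {f g : PowerSeries ℤ} {N q K B k : ℕ}
    (hg0 : 0 < coeff 0 g) (hf : suppCount f N ≤ 2 * q ^ K)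
    (hg : suppCount g N ^ B ≤ q) (J : Finset (ℕ × ℕ)) (hJ : J.card * 2 ^ k < q)
    (hJ1 : ∀ p ∈ J, p.1 ≤ k) (hJ2 : ∀ p ∈ J, p.2 ≤ B) :
    (monomialSupport f g J N).card < q ^ (K * k + 2) := by
  classical
  have hq : 0 < q := by omega
  have hsub : monomialSupport f g J N ⊆
      J.biUnion fun p => (Finset.range (N + 1)).filter
        fun n => coeff n (f ^ p.1 * g ^ p.2) ≠ 0 := by
    intro n hn
    obtain ⟨hn1, p, hp, hn2⟩ := mem_monomialSupport.1 hn
    exact Finset.mem_biUnion.2 ⟨p, hp, Finset.mem_filter.2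
      ⟨Finset.mem_range.2 (Nat.lt_succ_of_le hn1), hn2⟩⟩
  have hb : ∀ p ∈ J, ((Finset.range (N + 1)).filter
      fun n => coeff n (f ^ p.1 * g ^ p.2) ≠ 0).card ≤ (2 * q ^ K) ^ k * q := by
    intro p hp
    refine (suppCount_mul_le _ _ _).trans (Nat.mul_le_mul ?_ ?_)
    · refine (suppCount_pow_le _ _ _).trans ((Nat.pow_le_pow_left hf _).trans ?_)
      exact Nat.pow_le_pow_right (by positivity) (hJ1 p hp)
    · refine (suppCount_pow_le _ _ _).trans (le_trans ?_ hg)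
      exact Nat.pow_le_pow_right (one_le_suppCount hg0 N) (hJ2 p hp)
  calc _ ≤ J.card * ((2 * q ^ K) ^ k * q) :=
        (Finset.card_le_card hsub).trans (Finset.card_biUnion_le_card_mul _ _ _ hb)
    _ = (J.card * 2 ^ k) * (q ^ (K * k) * q) := by rw [mul_pow, ← pow_mul]; ring
    _ < q * (q ^ (K * k) * q) := Nat.mul_lt_mul_of_pos_right hJ (by positivity)
    _ = q ^ (K * k + 2) := by ring

theorem exists_leading_exponent_isolated {f g : PowerSeries ℤ} (hf : ∀ n, 0 ≤ coeff n f)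
    (hg : ∀ n, 0 ≤ coeff n g) (hg0 : 0 < coeff 0 g) {C : ℕ}
    (hC : ∀ R, 1 ≤ R → ∃ t, R ≤ t ∧ t ≤ C * R ∧ 0 < coeff t g) {N X1 X2 d E : ℕ}
    (A1 A2 : Finset ℕ) (cA1 : A1.card < X1) (cA2 : A2.card < X2)
    (hA2 : ∀ n, n ∈ A2 ↔ n ≤ N ∧ ∃ l ≤ E, coeff n (f ^ d * g ^ l) ≠ 0)
    (happ : ∀ R ≤ N, ∃ n ≤ R, 0 < coeff n (f ^ d) ∧ (R - n) * 16 * X1 ≤ N)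
    (hlarge : 4 * C ≤ N / X1 / 4 / X2) :
    ∃ r W t : ℕ, r + W ≤ N ∧ (∀ m, r < m → m ≤ r + W → m ∉ A1 ∧ m ∉ A2) ∧
      N / X1 / 4 / X2 ≤ W ∧ N / X1 / 4 / X2 / (4 * C) ≤ t ∧ 2 * t ≤ W ∧
      0 < coeff (r + t) (f ^ d * g ^ (E + 1)) := by
  classical
  have hC1 : 1 ≤ C := by
    obtain ⟨t, h1, h2, -⟩ := hC 1 le_rfl
    omega
  obtain ⟨p, -, hp2, hp3⟩ := exists_block_disjoint A1 cA1 0 N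
  rw [zero_add] at hp2
  generalize hL : N / X1 = L at *
  -- Aiming at the midpoint of the `A1`-free block with error at most L/16 keeps `n₀` inside it,
  -- with room of length L/4 to its right.
  obtain ⟨n₀, hn₀, hn₀pos, hn₀rem⟩ := happ (p + L / 2) (by omega)
  have hn₀L : (p + L / 2 - n₀) * 16 ≤ L := by
    refine le_of_le_of_eq ?_ hL
    exact (Nat.le_div_iff_mul_le (by omega)).2 hn₀rem
  have hn₀p : p ≤ n₀ := by omega
  obtain ⟨p', hp'1, hp'2, hp'3⟩ := exists_block_disjoint A2 cA2 n₀ (L / 4)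
  generalize L / 4 / X2 = H at *
  have hn₀A2 : n₀ ∈ A2.filter (· ≤ p') := by
    refine Finset.mem_filter.2 ⟨(hA2 _).2 ⟨by omega, 0, Nat.zero_le _, ?_⟩, hp'1⟩
    simpa using hn₀pos.ne'
  -- The last element of `A2` before its gap; it lies at or beyond `n₀`, so everything up to the end
  -- of that gap is also free of `A1`.
  obtain ⟨r, hr, hrmax⟩ := Finset.exists_max_image (A2.filter (· ≤ p')) id ⟨n₀, hn₀A2⟩
  have hrn₀ : n₀ ≤ r := hrmax n₀ hn₀A2
  obtain ⟨hrA2, hrp'⟩ := Finset.mem_filter.1 hr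
  have hfree2 : ∀ n, r < n → n ≤ p' + H → n ∉ A2 := by
    intro n h1 h2 h3
    by_cases h4 : n ≤ p'
    · exact absurd (hrmax n (Finset.mem_filter.2 ⟨h3, h4⟩)) (not_le.2 h1)
    · exact hp'3 n (by omega) h2 h3
  obtain ⟨-, l, hl, hrne⟩ := (hA2 _).1 hrA2
  obtain ⟨W, hW⟩ : ∃ W, r + W = p' + H := ⟨p' + H - r, by omega⟩
  -- Starting from W/(2C) gives t ≤ W/2, leaving as much room after r + t as before it.
  obtain ⟨t, ht1, ht2, htpos⟩ := hC (W / (2 * C)) (by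
    rw [Nat.le_div_iff_mul_le (by positivity)]
    omega)
  have hw : H / (4 * C) ≤ W / (2 * C) :=
    (Nat.div_le_div_left (by omega) (by positivity)).trans (Nat.div_le_div_right (by omega))
  have htW : 2 * t ≤ W := by
    have h1 := Nat.mul_div_le W (2 * C)
    have h2 : 2 * (C * (W / (2 * C))) = 2 * C * (W / (2 * C)) := by ring
    omega
  refine ⟨r, W, t, by omega, fun m h1 h2 => ⟨hp3 m (by omega) (by omega),
    hfree2 m h1 (by omega)⟩, by omega, by omega, htW, ?_⟩
  have hnn := coeff_mul_nonneg (coeff_pow_nonneg hf d) (coeff_pow_nonneg hg l)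
  have h1 := coeff_add_mul_pos hnn hg (lt_of_le_of_ne (hnn r) hrne.symm) htpos
  have h2 := coeff_mul_pow_pos (coeff_mul_nonneg hnn hg) hg hg0 h1 (E - l)
  rwa [mul_assoc, mul_assoc, ← pow_succ', ← pow_add,
    show l + (E - l + 1) = E + 1 by omega] at h2

/-- Since Z is at most √N/2, the quotient exceeds √N even after rounding. This secures R' ≤ N ≤ G²
for the final gap length G. -/
theorem le_div_and_le_sq_div {N Z q : ℕ} (hZ : 0 < Z) (hq : 4 ≤ q) (hN : q * Z ^ 2 ≤ N) :
    q ≤ N / Z ∧ N ≤ (N / Z) ^ 2 := by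
  have hGq : q ≤ N / Z := by
    rw [Nat.le_div_iff_mul_le hZ]
    exact le_trans (Nat.mul_le_mul_left _ (Nat.le_self_pow (by norm_num) Z)) hN
  refine ⟨hGq, ?_⟩
  set G := N / Z with hG
  have h1 : N < Z * (G + 1) := Nat.lt_mul_div_succ N hZ
  have h2 : N ≤ 2 * G * Z := by nlinarith
  have h3 : 4 * Z ^ 2 ≤ N := (Nat.mul_le_mul_right _ hq).trans hN
  have h4 : N * N ≤ G ^ 2 * N := by
    calc N * N ≤ (2 * G * Z) * (2 * G * Z) := Nat.mul_le_mul h2 h2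
      _ = G ^ 2 * (4 * Z ^ 2) := by ring
      _ ≤ G ^ 2 * N := Nat.mul_le_mul_left _ h3
  exact Nat.le_of_mul_le_mul_right h4 (lt_of_lt_of_le (by positivity) h3)

/-- For a polynomial expression in two series, the first of which is lacunary and the second of
which is much more lacunary, there are nonzero coefficients isolated from the coefficients of the
wrong sign and lying between two long runs of zero coefficients. -/
theorem exists_coeff_ne_zero_between_runs {f g : PowerSeries ℤ} (hf : ∀ n, 0 ≤ coeff n f)
    (hf0 : 0 < coeff 0 f) (hg : ∀ n, 0 ≤ coeff n g) (hg0 : 0 < coeff 0 g) {C : ℕ}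
    (hC : ∀ R, 1 ≤ R → ∃ t, R ≤ t ∧ t ≤ C * R ∧ 0 < coeff t g)
    (hfg : ∀ K A B : ℕ, ∀ᶠ q : ℕ in Filter.atTop, ∃ N, suppCount f N ≤ 2 * q ^ (K + 3) ∧
      suppCount g N ^ B ≤ q ∧ q ^ A ≤ N ∧
      ∀ R ≤ N, N ≤ R * q ^ A → ∃ s ≤ R, 0 < coeff s f ∧ (R - s) * q ^ (K + 1) ≤ R)
    (I : Finset (ℕ × ℕ)) (a : ℕ × ℕ → ℤ) {D E : ℕ} (htop : (D + 1, E + 1) ∈ I)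
    (hpos : 0 < a (D + 1, E + 1))
    (hlex : ∀ p ∈ I, p ≠ (D + 1, E + 1) → p.1 ≤ D ∨ p.1 = D + 1 ∧ p.2 ≤ E) {h : PowerSeries ℤ}
    (hh : ∀ n, coeff n h = ∑ p ∈ I, a p * coeff n (f ^ p.1 * g ^ p.2)) (G₀ : ℕ) :
    ∃ G R R' n : ℕ, G₀ ≤ G ∧ R' ≤ G ^ 2 ∧ R < n ∧ n ≤ R' ∧
      (∀ n, R < n → n ≤ R + G → coeff n h = 0) ∧
      (∀ n, R' < n → n ≤ R' + G → coeff n h = 0) ∧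
      (∀ n, R < n → n ≤ R' → 0 ≤ coeff n h) ∧ coeff n h ≠ 0 := by
  have hC1 : 1 ≤ C := by
    obtain ⟨t, h1, h2, -⟩ := hC 1 le_rfl
    omega
  -- This choice makes (K+1)(D+1) = (K+3)D + 4, so the approximation error of f^(D+1) is smaller by
  -- q² than the length N/X1 of the `A1`-free gap.
  obtain ⟨K, hK⟩ : ∃ K, K = 2 * D + 3 := ⟨_, rfl⟩
  -- Here q^e = X1 · X2² · q, and the last q dominates 16C; so N/q^e is a lower bound for the gap
  -- length obtained after all divisions.
  obtain ⟨e, he⟩ : ∃ e, e = (K + 3) * D + 2 + 2 * ((K + 3) * (D + 1) + 2) + 1 := ⟨_, rfl⟩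
  obtain ⟨q, ⟨N, hfN, hgN, hqN, hstep⟩, hq1⟩ := ((hfg K (2 * e + 1)
    (I.sup Prod.snd + E)).and (Filter.eventually_ge_atTop
    ((I.card + E + 2) * 2 ^ (D + 1) + 16 * C + G₀ + 4))).exists
  have hqC : 16 * C ≤ q := by omega
  have hq4 : 4 ≤ q := by omega
  have hqcard : ∀ m ≤ I.card + E + 1, ∀ k ≤ D + 1, m * 2 ^ k < q := by
    intro m hm k hk
    have h1 : 2 ^ k ≤ 2 ^ (D + 1) := Nat.pow_le_pow_right (by norm_num) hk
    have h2 : m * 2 ^ k ≤ (I.card + E + 2) * 2 ^ (D + 1) := Nat.mul_le_mul (by omega) h1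
    omega
  have hIB : ∀ p ∈ I, p.2 ≤ I.sup Prod.snd + E := fun p hp =>
    (Finset.le_sup (f := Prod.snd) hp).trans (Nat.le_add_right _ _)
  have hID : ∀ p ∈ I, p.1 ≤ D + 1 := by
    intro p hp
    by_cases hpt : p = (D + 1, E + 1)
    · rw [hpt]
    · rcases hlex p hp hpt with h | h <;> omega
  set A1 := monomialSupport f g (I.filter fun p => p.1 ≤ D) N with hA1
  set A2 := monomialSupport f g (({D + 1} : Finset ℕ) ×ˢ Finset.range (E + 1)) N with hA2
  set A3 := monomialSupport f g I N with hA3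
  have cA1 : A1.card < q ^ ((K + 3) * D + 2) := card_monomialSupport_lt hg0 hfN hgN _
    (hqcard _ ((Finset.card_filter_le _ _).trans (by omega)) D (by omega))
    (fun p hp => (Finset.mem_filter.1 hp).2) (fun p hp => hIB p (Finset.mem_filter.1 hp).1)
  have cA2 : A2.card < q ^ ((K + 3) * (D + 1) + 2) := card_monomialSupport_lt hg0 hfN hgN _
    (hqcard _ (by rw [Finset.card_product, Finset.card_singleton, Finset.card_range]; omega) _
      le_rfl)
    (fun p hp => (Finset.mem_singleton.1 (Finset.mem_product.1 hp).1).le)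
    (fun p hp => by
      have := Finset.mem_range.1 (Finset.mem_product.1 hp).2
      omega)
  have cA3 : A3.card < q ^ ((K + 3) * (D + 1) + 2) := card_monomialSupport_lt hg0 hfN hgN _
    (hqcard _ (by omega) _ le_rfl) hID hIB
  have hA2mem : ∀ n, n ∈ A2 ↔ n ≤ N ∧ ∃ l ≤ E, coeff n (f ^ (D + 1) * g ^ l) ≠ 0 := by
    intro n
    simp [hA2, mem_monomialSupport]
  have hzero : ∀ n ≤ N, n ∉ A3 → coeff n h = 0 := by
    intro n hn hnA
    rw [hh]
    refine Finset.sum_eq_zero fun p hp => ?_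
    by_contra hne
    exact hnA (mem_monomialSupport.2 ⟨hn, p, hp, right_ne_zero_of_mul hne⟩)
  have htopc : ∀ n ≤ N, n ∉ A1 ∧ n ∉ A2 →
      coeff n h = a (D + 1, E + 1) * coeff n (f ^ (D + 1) * g ^ (E + 1)) := by
    rintro n hn ⟨h1, h2⟩
    rw [hh]
    refine Finset.sum_eq_single_of_mem _ htop fun p hp hpt => ?_
    by_contra hne
    rcases hlex p hp hpt with hlow | ⟨hl1, hl2⟩
    · exact h1 (mem_monomialSupport.2 ⟨hn, p, Finset.mem_filter.2 ⟨hp, hlow⟩,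
        right_ne_zero_of_mul hne⟩)
    · refine h2 ((hA2mem n).2 ⟨hn, p.2, hl2, ?_⟩)
      rw [← hl1]
      exact right_ne_zero_of_mul hne
  have happ : ∀ R ≤ N, ∃ n ≤ R, 0 < coeff n (f ^ (D + 1)) ∧
      (R - n) * 16 * q ^ ((K + 3) * D + 2) ≤ N := by
    intro R hR
    obtain ⟨n, hn, hn1, hn2⟩ := exists_coeff_pow_pos_near hf hf0 (D := D + 1)
      (Q := q ^ (K + 1)) (Y := q ^ (2 * e + 1)) (Nat.one_le_pow _ _ (by omega))
      (by
        rw [← pow_mul]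
        refine Nat.pow_le_pow_right (by omega) ?_
        rw [he]
        nlinarith)
      hstep hR le_rfl
    refine ⟨n, hn, hn1, le_trans ?_ hn2⟩
    rw [mul_assoc]
    refine Nat.mul_le_mul_left _ ?_
    calc 16 * q ^ ((K + 3) * D + 2) ≤ q ^ 2 * q ^ ((K + 3) * D + 2) :=
          Nat.mul_le_mul_right _ (by nlinarith)
      _ = (q ^ (K + 1)) ^ (D + 1) := by
          rw [← pow_add, ← pow_mul, hK]
          congr 1
          ring
  generalize hX1 : q ^ ((K + 3) * D + 2) = X1 at *
  generalize hX2 : q ^ ((K + 3) * (D + 1) + 2) = X2 at *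
  have hX1p : 0 < X1 := by omega
  have hX2p : 0 < X2 := by omega
  have hNZ : q * (X1 * 4 * X2 * (4 * C) * X2) ^ 2 ≤ N := by
    refine le_trans ?_ hqN
    calc q * (X1 * 4 * X2 * (4 * C) * X2) ^ 2 = q * (X1 * X2 * X2 * (16 * C)) ^ 2 := by ring
      _ ≤ q * (X1 * X2 * X2 * q) ^ 2 := by gcongr
      _ = q ^ (2 * e + 1) := by rw [← hX1, ← hX2, he]; ring
  obtain ⟨hGq, hG2⟩ := le_div_and_le_sq_div (by positivity) hq4 hNZ
  have hdiv : N / (X1 * 4 * X2 * (4 * C) * X2) = N / X1 / 4 / X2 / (4 * C) / X2 := by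
    simp only [Nat.div_div_eq_div_mul, mul_assoc]
  rw [hdiv] at hGq hG2
  have hHw : 4 * C * (N / X1 / 4 / X2 / (4 * C)) ≤ N / X1 / 4 / X2 := Nat.mul_div_le _ _
  have hGw : N / X1 / 4 / X2 / (4 * C) / X2 ≤ N / X1 / 4 / X2 / (4 * C) := Nat.div_le_self _ _
  have hlarge : 4 * C ≤ N / X1 / 4 / X2 := by
    refine le_trans ?_ hHw
    exact Nat.le_mul_of_pos_right _ (by omega)
  obtain ⟨r, W, t, hrW, hfree, hHW, hwt, htW, hnpos⟩ :=
    exists_leading_exponent_isolated hf hg hg0 hC A1 A2 cA1 cA2 hA2mem happ hlarge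
  have hwH : 4 * (N / X1 / 4 / X2 / (4 * C)) ≤ N / X1 / 4 / X2 :=
    le_trans (Nat.mul_le_mul_right _ (by omega)) hHw
  generalize N / X1 / 4 / X2 = H at *
  generalize H / (4 * C) = w at *
  -- Both blocks stay within (r, r + W], because w ≤ t and 2t ≤ W.
  obtain ⟨R, hR1, hR2, hR3⟩ := exists_block_disjoint A3 cA3 (r + t - w) w
  obtain ⟨R', hR'1, hR'2, hR'3⟩ := exists_block_disjoint A3 cA3 (r + t) w
  generalize w / X2 = G at *
  refine ⟨G, R, R', r + t, by omega, by omega, by omega, hR'1, ?_, ?_, ?_, ?_⟩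
  · exact fun m h1 h2 => hzero m (by omega) (hR3 m h1 h2)
  · exact fun m h1 h2 => hzero m (by omega) (hR'3 m h1 h2)
  · intro m h1 h2
    rw [htopc m (by omega) (hfree m (by omega) (by omega))]
    exact mul_nonneg hpos.le (coeff_mul_nonneg (coeff_pow_nonneg hf _) (coeff_pow_nonneg hg _) m)
  · rw [htopc _ (by omega) (hfree _ (by omega) (by omega))]
    exact (mul_pos hpos hnpos).ne'

/-! ### Growth and regularity of φ -/

/-- Up to a factor tending to 1 + y, this is the derivative of log φ in the variable u = log R. For
y > 0 the power of u absorbs a possibly negative z. -/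
theorem tendsto_rpow_mul_log_rpow_atTop {y z : ℝ} (h : (y, z) ∈ BetaExpansion.Theta) :
    Tendsto (fun u : ℝ => u ^ y * Real.log u ^ z) atTop atTop := by
  rcases h with hy | ⟨hy, hz⟩
  · simp only at hy
    refine tendsto_atTop_mono' atTop ?_ (tendsto_rpow_atTop (half_pos hy))
    filter_upwards [(isLittleO_log_rpow_rpow_atTop (-z) (half_pos hy)).bound one_pos,
      eventually_gt_atTop (Real.exp 1)] with u hu hu1
    have hu0 : 0 < u := (Real.exp_pos 1).trans hu1
    have hlog : 0 < Real.log u := one_pos.trans ((Real.lt_log_iff_exp_lt hu0).2 hu1)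
    rw [one_mul, Real.norm_of_nonneg (by positivity), Real.norm_of_nonneg (by positivity),
      Real.rpow_neg hlog.le, inv_le_comm₀ (by positivity) (by positivity)] at hu
    calc u ^ (y / 2) = u ^ y * (u ^ (y / 2))⁻¹ := by
          rw [← Real.rpow_neg hu0.le, ← Real.rpow_add hu0]
          congr 1
          ring
      _ ≤ u ^ y * Real.log u ^ z := by gcongr
  · simp only at hy hz
    subst hy
    simpa [Function.comp_def] using (tendsto_rpow_atTop hz).comp Real.tendsto_log_atTop

theorem hasDerivAt_rpow_mul_log_rpow (y z : ℝ) {u : ℝ} (hu : 1 < u) :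
    HasDerivAt (fun u : ℝ => u ^ (1 + y) * Real.log u ^ z)
      (u ^ y * Real.log u ^ z * ((1 + y) + z / Real.log u)) u := by
  have hu0 : 0 < u := one_pos.trans hu
  have hlog : 0 < Real.log u := Real.log_pos hu
  have h1 := Real.hasDerivAt_rpow_const (x := u) (p := 1 + y) (Or.inl hu0.ne')
  have h2 := (Real.hasDerivAt_log hu0.ne').rpow_const (p := z) (Or.inl hlog.ne')
  refine (h1.fun_mul h2).congr_deriv ?_
  rw [show 1 + y - 1 = y by ring, Real.rpow_sub_one hlog.ne', Real.rpow_add hu0, Real.rpow_one]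
  field_simp

theorem exists_mul_sub_le_sub_of_mem_Theta {y z : ℝ} (h : (y, z) ∈ BetaExpansion.Theta) (Λ : ℝ) :
    ∃ u₀, ∀ u u' : ℝ, u₀ ≤ u → u ≤ u' → Λ * (u' - u) ≤
      u' ^ (1 + y) * Real.log u' ^ z - u ^ (1 + y) * Real.log u ^ z := by
  have hy : 0 ≤ y := by
    rcases h with hy | ⟨hy, -⟩
    · exact le_of_lt hy
    · exact le_of_eq hy.symm
  have hz : Tendsto (fun u : ℝ => (1 + y) + z / Real.log u) atTop (nhds ((1 + y) + 0)) :=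
    tendsto_const_nhds.add (Tendsto.const_div_atTop Real.tendsto_log_atTop z)
  obtain ⟨u₀, hu₀⟩ := eventually_atTop.1 (((tendsto_rpow_mul_log_rpow_atTop h).eventually_ge_atTop
    (2 * |Λ|)).and ((hz.eventually_const_le (show 1 / 2 < (1 + y) + 0 by linarith)).and
      (eventually_gt_atTop (1 : ℝ))))
  refine ⟨u₀, fun u u' hu huu => ?_⟩
  have hder : ∀ v ∈ Set.Icc u u', HasDerivAt (fun u : ℝ => u ^ (1 + y) * Real.log u ^ z)
      (v ^ y * Real.log v ^ z * ((1 + y) + z / Real.log v)) v := fun v hv =>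
    hasDerivAt_rpow_mul_log_rpow y z (hu₀ v (hu.trans hv.1)).2.2
  refine (convex_Icc u u').mul_sub_le_image_sub_of_le_deriv
    (fun v hv => (hder v hv).continuousAt.continuousWithinAt)
    (fun v hv => (hder v (interior_subset hv)).differentiableAt.differentiableWithinAt)
    (fun v hv => ?_) u (Set.left_mem_Icc.2 huu) u' (Set.right_mem_Icc.2 huu) huu
  rw [(hder v (interior_subset hv)).deriv]
  obtain ⟨h1, h2, -⟩ := hu₀ v (hu.trans (interior_subset hv).1)
  nlinarith [le_abs_self Λ, abs_nonneg Λ]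

/-- The derivative of log φ in u = log R is at most a power of u. This yields both the small
relative gaps of φ and its subexponential size. -/
theorem exists_sub_le_pow_mul_sub (y z : ℝ) :
    ∃ (c : ℕ) (u₀ : ℝ), ∀ u u' : ℝ, u₀ ≤ u → u ≤ u' →
      u' ^ (1 + y) * Real.log u' ^ z - u ^ (1 + y) * Real.log u ^ z ≤ u' ^ c * (u' - u) := by
  obtain ⟨u₀, hu₀⟩ := eventually_atTop.1 (((isLittleO_log_rpow_rpow_atTop z
    (one_pos)).bound one_pos).and ((eventually_ge_atTop (Real.exp 1)).and
      (eventually_ge_atTop (1 + |y| + |z|))))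
  refine ⟨⌈|y|⌉₊ + 2, u₀, fun u u' hu huu => ?_⟩
  have hgt : ∀ v, Real.exp 1 ≤ v → 1 < v := fun v hv =>
    (Real.one_lt_exp_iff.2 one_pos).trans_le hv
  have hder : ∀ v ∈ Set.Icc u u', HasDerivAt (fun u : ℝ => u ^ (1 + y) * Real.log u ^ z)
      (v ^ y * Real.log v ^ z * ((1 + y) + z / Real.log v)) v := fun v hv =>
    hasDerivAt_rpow_mul_log_rpow y z (hgt v (hu₀ v (hu.trans hv.1)).2.1)
  refine (convex_Icc u u').image_sub_le_mul_sub_of_deriv_le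
    (fun v hv => (hder v hv).continuousAt.continuousWithinAt)
    (fun v hv => (hder v (interior_subset hv)).differentiableAt.differentiableWithinAt)
    (fun v hv => ?_) u (Set.left_mem_Icc.2 huu) u' (Set.right_mem_Icc.2 huu) huu
  have hv' := interior_subset hv
  rw [(hder v hv').deriv]
  obtain ⟨h1, h2, h3⟩ := hu₀ v (hu.trans hv'.1)
  have hv1 : 1 < v := hgt v h2
  have hv0 : 0 < v := one_pos.trans hv1
  have hlog : 1 ≤ Real.log v := (Real.le_log_iff_exp_le hv0).2 h2
  have hlog0 : 0 < Real.log v := one_pos.trans_le hlog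
  rw [one_mul, Real.norm_of_nonneg (by positivity), Real.rpow_one, Real.norm_of_nonneg hv0.le] at h1
  have e1 : (1 + y) + z / Real.log v ≤ v := by
    refine le_trans ?_ h3
    have : z / Real.log v ≤ |z| := by
      rw [div_le_iff₀ hlog0]
      nlinarith [le_abs_self z, abs_nonneg z]
    linarith [le_abs_self y]
  have e2 : v ^ y ≤ v ^ ⌈|y|⌉₊ := by
    rw [← Real.rpow_natCast]
    exact Real.rpow_le_rpow_of_exponent_le hv1.le ((le_abs_self y).trans (Nat.le_ceil _))
  calc v ^ y * Real.log v ^ z * ((1 + y) + z / Real.log v)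
      ≤ v ^ y * Real.log v ^ z * v := mul_le_mul_of_nonneg_left e1 (by positivity)
    _ ≤ v ^ ⌈|y|⌉₊ * v * v := by gcongr
    _ = v ^ (⌈|y|⌉₊ + 2) := by ring
    _ ≤ u' ^ (⌈|y|⌉₊ + 2) := by
        gcongr
        exact hv'.2

section Phi

variable {y z : ℝ}

theorem phi_pos (y z R : ℝ) : 0 < BetaExpansion.phi y z R := Real.exp_pos _

/-- Eventually φ(j)/φ(i) ≥ (j/i)^Λ, since log φ has slope at least Λ in log R. -/
theorem exists_phi_mul_pow_le (h : (y, z) ∈ BetaExpansion.Theta) (Λ : ℕ) :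
    ∃ M : ℕ, 1 ≤ M ∧ ∀ i j : ℕ, M ≤ i → i ≤ j →
      BetaExpansion.phi y z i * (j : ℝ) ^ Λ ≤ BetaExpansion.phi y z j * (i : ℝ) ^ Λ := by
  obtain ⟨u₀, hu₀⟩ := exists_mul_sub_le_sub_of_mem_Theta h Λ
  obtain ⟨M, hM⟩ := exists_nat_ge (Real.exp u₀)
  refine ⟨M + 1, by omega, fun i j hi hij => ?_⟩
  have hi0 : (0 : ℝ) < i := by exact_mod_cast (show 0 < i by omega)
  have hj0 : (0 : ℝ) < j := by exact_mod_cast (show 0 < j by omega)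
  have hi1 : u₀ ≤ Real.log i := by
    rw [Real.le_log_iff_exp_le hi0]
    exact hM.trans (by exact_mod_cast (show M ≤ i by omega))
  have key := hu₀ _ _ hi1 (Real.log_le_log hi0 (show (i : ℝ) ≤ j by exact_mod_cast hij))
  have hpow : ∀ x : ℝ, 0 < x → x ^ Λ = Real.exp (Λ * Real.log x) := fun x hx => by
    rw [mul_comm, ← Real.rpow_def_of_pos hx, Real.rpow_natCast]
  rw [hpow _ hi0, hpow _ hj0, BetaExpansion.phi, BetaExpansion.phi, ← Real.exp_add,
    ← Real.exp_add, Real.exp_le_exp]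
  linarith

theorem eventually_pow_le_phi (h : (y, z) ∈ BetaExpansion.Theta) (Λ : ℕ) :
    ∀ᶠ i : ℕ in atTop, (i : ℝ) ^ Λ ≤ BetaExpansion.phi y z i := by
  obtain ⟨M, hM1, hM⟩ := exists_phi_mul_pow_le h (Λ + 1)
  have hφ := phi_pos y z M
  have hM0 : (0 : ℝ) < M := by exact_mod_cast (show 0 < M by omega)
  filter_upwards [eventually_ge_atTop M, tendsto_natCast_atTop_atTop.eventually_ge_atTop
    ((M : ℝ) ^ (Λ + 1) / BetaExpansion.phi y z M)] with i hi hi2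
  rw [div_le_iff₀ hφ] at hi2
  have h1 := hM M i le_rfl hi
  have h2 : (i : ℝ) ^ Λ * (M : ℝ) ^ (Λ + 1) ≤ BetaExpansion.phi y z i * (M : ℝ) ^ (Λ + 1) := by
    calc (i : ℝ) ^ Λ * (M : ℝ) ^ (Λ + 1) ≤ (i : ℝ) ^ Λ * (i * BetaExpansion.phi y z M) := by gcongr
      _ = BetaExpansion.phi y z M * (i : ℝ) ^ (Λ + 1) := by ring
      _ ≤ _ := h1
  exact le_of_mul_le_mul_right h2 (by positivity)

/-- Passing from i to i + 1 moves log i by at most 1/i, so φ changes by a relative amount of order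
(log i)^c / i. -/
theorem exists_phi_succ_le (y z : ℝ) : ∃ c : ℕ, ∀ᶠ i : ℕ in atTop,
    BetaExpansion.phi y z ((i + 1 : ℕ) : ℝ) ≤
      BetaExpansion.phi y z i * Real.exp (Real.log ((i + 1 : ℕ) : ℝ) ^ c / i) := by
  obtain ⟨c, u₀, hu₀⟩ := exists_sub_le_pow_mul_sub y z
  obtain ⟨M, hM⟩ := exists_nat_ge (Real.exp u₀)
  refine ⟨c, ?_⟩
  filter_upwards [eventually_ge_atTop (M + 1)] with i hi
  have hi0 : (0 : ℝ) < i := by exact_mod_cast (show 0 < i by omega)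
  have hi1 : u₀ ≤ Real.log i := by
    rw [Real.le_log_iff_exp_le hi0]
    exact hM.trans (by exact_mod_cast (show M ≤ i by omega))
  have hle : (i : ℝ) ≤ ((i + 1 : ℕ) : ℝ) := by push_cast; linarith
  have key := hu₀ _ _ hi1 (Real.log_le_log hi0 hle)
  have hlog : Real.log ((i + 1 : ℕ) : ℝ) - Real.log i ≤ 1 / i := by
    rw [← Real.log_div (by positivity) hi0.ne']
    refine (Real.log_le_sub_one_of_pos (by positivity)).trans (le_of_eq ?_)
    push_cast
    field_simp
    ring
  have hpos : 0 ≤ Real.log ((i + 1 : ℕ) : ℝ) ^ c :=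
    pow_nonneg (Real.log_nonneg (by push_cast; linarith)) _
  rw [BetaExpansion.phi, BetaExpansion.phi, ← Real.exp_add, Real.exp_le_exp]
  have := mul_le_mul_of_nonneg_left hlog hpos
  rw [mul_one_div] at this
  linarith

theorem exists_log_phi_le (y z : ℝ) : ∃ c : ℕ, ∀ᶠ i : ℕ in atTop,
    Real.log (BetaExpansion.phi y z i) ≤ Real.log i ^ c := by
  obtain ⟨c, u₀, hu₀⟩ := exists_sub_le_pow_mul_sub y z
  refine ⟨c + 2, ?_⟩
  set F₀ := u₀ ^ (1 + y) * Real.log u₀ ^ z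
  have hlim := Real.tendsto_log_atTop.comp (tendsto_natCast_atTop_atTop (R := ℝ))
  filter_upwards [hlim.eventually_ge_atTop (|u₀| + |F₀| + 2)] with i hi
  simp only [Function.comp] at hi
  have hu0 := le_abs_self u₀
  have hu0' := neg_abs_le u₀
  have hF0 := abs_nonneg F₀
  have hu0'' := abs_nonneg u₀
  have key := hu₀ u₀ (Real.log i) le_rfl (by linarith)
  rw [BetaExpansion.phi, Real.log_exp]
  set u := Real.log (i : ℝ)
  have h1 : 1 ≤ u ^ c := one_le_pow₀ (by linarith)
  have h2 : u ^ c * (u - u₀) ≤ u ^ c * (u + |u₀|) := by gcongr; linarith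
  have h3 : F₀ ≤ u ^ c * |F₀| := by nlinarith [le_abs_self F₀]
  have h4 : u ^ c * (u + |u₀| + |F₀|) ≤ u ^ c * (u * u) := by
    gcongr
    nlinarith
  calc _ ≤ F₀ + u ^ c * (u - u₀) := by linarith
    _ ≤ u ^ c * (u + |u₀| + |F₀|) := by nlinarith
    _ ≤ u ^ c * (u * u) := h4
    _ = u ^ (c + 2) := by ring

end Phi

theorem eventually_mul_log_pow_le (a : ℝ) (c : ℕ) :
    ∀ᶠ q : ℕ in atTop, a * Real.log q ^ c ≤ q := by
  have h := (Real.isLittleO_pow_log_id_atTop (n := c)).bound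
    (show (0 : ℝ) < (|a| + 1)⁻¹ by positivity)
  filter_upwards [tendsto_natCast_atTop_atTop.eventually h, eventually_ge_atTop 1] with q hq hq1
  have hlog : 0 ≤ Real.log (q : ℝ) := Real.log_nonneg (by exact_mod_cast hq1)
  rw [Real.norm_of_nonneg (by positivity), id, Real.norm_of_nonneg (by positivity),
    inv_mul_eq_div, le_div_iff₀ (by positivity)] at hq
  nlinarith [le_abs_self a, pow_nonneg hlog c]

/-! ### Exponents of the two series -/

theorem coeff_onePlusSeries (s : ℕ → ℕ) (n : ℕ) :
    coeff n (onePlusSeries s) = (if n = 0 then 1 else 0) + (Nat.card {i // s i = n} : ℤ) := by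
  rw [onePlusSeries, map_add, coeff_one, coeff_mk]

theorem coeff_onePlusSeries_nonneg (s : ℕ → ℕ) (n : ℕ) : 0 ≤ coeff n (onePlusSeries s) := by
  rw [coeff_onePlusSeries]
  split_ifs <;> positivity

theorem coeff_zero_onePlusSeries_pos (s : ℕ → ℕ) : 0 < coeff 0 (onePlusSeries s) := by
  rw [coeff_onePlusSeries, if_pos rfl]
  positivity

theorem coeff_onePlusSeries_pos {s : ℕ → ℕ} (hfin : ∀ n, {i | s i = n}.Finite) (i : ℕ) :
    0 < coeff (s i) (onePlusSeries s) := by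
  have : Finite {j // s j = s i} := hfin (s i)
  have : Nonempty {j // s j = s i} := ⟨⟨i, rfl⟩⟩
  have : 0 < (Nat.card {j // s j = s i} : ℤ) := by exact_mod_cast Nat.card_pos
  rw [coeff_onePlusSeries]
  split_ifs <;> omega

theorem suppCount_onePlusSeries_le {s : ℕ → ℕ} {N m : ℕ} (h : ∀ i, s i ≤ N → i < m) :
    suppCount (onePlusSeries s) N ≤ m + 1 := by
  classical
  have hsub : ((Finset.range (N + 1)).filter fun n => coeff n (onePlusSeries s) ≠ 0) ⊆
      insert 0 ((Finset.range m).image s) := by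
    intro n hn
    obtain ⟨hn1, hn2⟩ := Finset.mem_filter.1 hn
    rw [coeff_onePlusSeries] at hn2
    rw [Finset.mem_insert]
    by_cases hn0 : n = 0
    · exact Or.inl hn0
    · right
      rw [if_neg hn0, zero_add, Nat.cast_ne_zero] at hn2
      obtain ⟨⟨i, hi⟩⟩ := (Nat.card_ne_zero.1 hn2).1
      exact Finset.mem_image.2 ⟨i, Finset.mem_range.2 (h i (by
        rw [hi]
        exact Nat.lt_succ_iff.1 (Finset.mem_range.1 hn1))), hi⟩
  calc _ ≤ (insert 0 ((Finset.range m).image s)).card := Finset.card_le_card hsub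
    _ ≤ ((Finset.range m).image s).card + 1 := Finset.card_insert_le _ _
    _ ≤ m + 1 := by
      have := Finset.card_image_le (s := Finset.range m) (f := s)
      rw [Finset.card_range] at this
      omega

theorem finite_fiber_of_le_mul {s : ℕ → ℕ} {M : ℕ} (h : ∀ i, i ≤ M * (s i + 1)) (n : ℕ) :
    {i | s i = n}.Finite :=
  (Set.finite_Iic (M * (n + 1))).subset fun i hi => by
    have := h i
    rw [show s i = n from hi] at this
    exact this

/-- At least linear growth of the exponents leaves O(n) indices in the fibre over n. -/
theorem onePlusSeries_mem_polyGrowth {s : ℕ → ℕ} {M : ℕ} (h : ∀ i, i ≤ M * (s i + 1)) :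
    onePlusSeries s ∈ polyGrowth := by
  refine ⟨M + 2, 1, fun n => ?_⟩
  rw [abs_of_nonneg (coeff_onePlusSeries_nonneg s n), coeff_onePlusSeries]
  have hcard : Nat.card {i // s i = n} ≤ M * (n + 1) + 1 := by
    have hsub : {i | s i = n} ⊆ (Finset.range (M * (n + 1) + 1) : Set ℕ) := fun i hi => by
      have := h i
      rw [show s i = n from hi] at this
      simpa using Nat.lt_succ_of_le this
    have := Set.ncard_le_ncard hsub (Finset.finite_toSet _)
    rw [Set.ncard_coe_finset, Finset.card_range] at this
    exact this
  have hcard' : (Nat.card {i // s i = n} : ℤ) ≤ M * (n + 1) + 1 := by exact_mod_cast hcard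
  push_cast
  rw [pow_one]
  split_ifs <;> nlinarith

/-- The exponents of the series `xi`. -/
noncomputable def phiExponent (y z : ℝ) (i : ℕ) : ℕ :=
  ⌊BetaExpansion.phi y z ((i + 3 : ℕ) : ℝ)⌋₊

theorem exists_le_mul_phiExponent {y z : ℝ} (h : (y, z) ∈ BetaExpansion.Theta) :
    ∃ M, ∀ i, i ≤ M * (phiExponent y z i + 1) := by
  obtain ⟨M, hM⟩ := eventually_atTop.1 (eventually_pow_le_phi h 1)
  refine ⟨M + 1, fun i => ?_⟩
  by_cases hi : M ≤ i
  · have h1 := hM (i + 3) (by omega)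
    rw [pow_one] at h1
    have h2 : i + 3 ≤ phiExponent y z i := Nat.le_floor h1
    nlinarith
  · nlinarith

theorem exists_le_mul_floor_pow {x : ℝ} (hx : 1 < x) : ∃ M : ℕ, ∀ i : ℕ, i ≤ M * (⌊x ^ i⌋₊ + 1) := by
  have hx' : 0 < x - 1 := by linarith
  obtain ⟨M, hM⟩ := exists_nat_ge (1 / (x - 1))
  refine ⟨M, fun i => ?_⟩
  have h1 := one_add_mul_sub_le_pow (a := x) (by linarith) i
  have h2 := Nat.lt_floor_add_one (x ^ i)
  rw [div_le_iff₀ hx'] at hM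
  have h3 : (i : ℝ) ≤ M * (⌊x ^ i⌋₊ + 1) := by
    have h4 : (i : ℝ) * (x - 1) ≤ (⌊x ^ i⌋₊ + 1) := by linarith
    have hi : (0 : ℝ) ≤ i := Nat.cast_nonneg i
    have hM0 : (0 : ℝ) ≤ M := Nat.cast_nonneg M
    calc (i : ℝ) ≤ i * (M * (x - 1)) := by nlinarith
      _ = M * (i * (x - 1)) := by ring
      _ ≤ _ := by gcongr
  exact_mod_cast h3

theorem exists_floor_pow_mem_Icc {x : ℝ} (hx : 1 < x) {R : ℕ} (hR : 1 ≤ R) :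
    ∃ i : ℕ, R ≤ ⌊x ^ i⌋₊ ∧ ⌊x ^ i⌋₊ ≤ ⌈x⌉₊ * R := by
  classical
  have hex : ∃ i : ℕ, (R : ℝ) ≤ x ^ i := by
    obtain ⟨i, hi⟩ := pow_unbounded_of_one_lt (R : ℝ) hx
    exact ⟨i, hi.le⟩
  have hspec := Nat.find_spec hex
  refine ⟨Nat.find hex, Nat.le_floor hspec, ?_⟩
  have hceil := Nat.le_ceil x
  have hR1 : (1 : ℝ) ≤ R := by exact_mod_cast hR
  have key : x ^ Nat.find hex ≤ ((⌈x⌉₊ * R : ℕ) : ℝ) := by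
    push_cast
    rcases Nat.eq_zero_or_pos (Nat.find hex) with h0 | hpos
    · rw [h0, pow_zero]
      nlinarith
    · obtain ⟨j, hj⟩ := Nat.exists_eq_add_one_of_ne_zero hpos.ne'
      have hlt := not_le.1 (Nat.find_min hex (m := j) (by omega))
      rw [hj, pow_succ]
      nlinarith
  exact_mod_cast (Nat.floor_le (by positivity)).trans key

theorem exists_suppCount_floor_pow_le {x : ℝ} (hx : 1 < x) : ∃ c : ℝ, 0 ≤ c ∧ ∀ N : ℕ,
    (suppCount (onePlusSeries fun i => ⌊x ^ i⌋₊) N : ℝ) ≤ c * (1 + Real.log (N + 1)) := by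
  have hlx : 0 < Real.log x := Real.log_pos hx
  refine ⟨3 + 1 / Real.log x, by positivity, fun N => ?_⟩
  have hlN : 0 ≤ Real.log ((N : ℝ) + 1) :=
    Real.log_nonneg (by linarith [(Nat.cast_nonneg N : (0 : ℝ) ≤ N)])
  have h1 : suppCount (onePlusSeries fun i => ⌊x ^ i⌋₊) N ≤
      (⌊Real.log ((N : ℝ) + 1) / Real.log x⌋₊ + 1) + 1 := by
    refine suppCount_onePlusSeries_le fun i hi => Nat.lt_succ_of_le (Nat.le_floor ?_)
    rw [le_div_iff₀ hlx, ← Real.log_pow]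
    refine Real.log_le_log (by positivity) ((Nat.lt_floor_add_one _).le.trans ?_)
    exact_mod_cast Nat.succ_le_succ hi
  have h2 : (⌊Real.log ((N : ℝ) + 1) / Real.log x⌋₊ : ℝ) ≤ Real.log ((N : ℝ) + 1) / Real.log x :=
    Nat.floor_le (by positivity)
  have h3 : (suppCount (onePlusSeries fun i => ⌊x ^ i⌋₊) N : ℝ) ≤
      (⌊Real.log ((N : ℝ) + 1) / Real.log x⌋₊ : ℝ) + 1 + 1 := by exact_mod_cast h1
  have h4 : 0 ≤ 1 / Real.log x := by positivity
  have h5 : Real.log ((N : ℝ) + 1) / Real.log x = 1 / Real.log x * Real.log ((N : ℝ) + 1) := by ring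
  rw [h5] at h2 h3
  nlinarith

theorem eventually_suppCount_phiExponent_le {y z : ℝ} (h : (y, z) ∈ BetaExpansion.Theta) :
    ∀ᶠ m : ℕ in atTop,
      suppCount (onePlusSeries (phiExponent y z)) ⌊BetaExpansion.phi y z m⌋₊ ≤ 2 * m := by
  obtain ⟨M, hM1, hM⟩ := exists_phi_mul_pow_le h 1
  filter_upwards [eventually_ge_atTop (M + 3), eventually_pow_le_phi h 1] with m hm hφ
  rw [pow_one] at hφ
  have hm3 : (3 : ℝ) ≤ m := by exact_mod_cast (show 3 ≤ m by omega)
  -- Since φ(2m) ≥ 2φ(m), only arguments below 2m matter; the 3 is the index shift, and the bound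
  -- leaves room for the constant term.
  refine (suppCount_onePlusSeries_le (m := 2 * m - 3) fun i hi => ?_).trans (by omega)
  by_contra hlt
  have h1 := hM m (i + 3) (by omega) (by omega)
  rw [pow_one, pow_one] at h1
  have h2 : (2 : ℝ) * m ≤ ((i + 3 : ℕ) : ℝ) := by exact_mod_cast (show 2 * m ≤ i + 3 by omega)
  have hpos := phi_pos y z m
  have h3 : BetaExpansion.phi y z m * 2 ≤ BetaExpansion.phi y z ((i + 3 : ℕ) : ℝ) := by
    have : BetaExpansion.phi y z m * 2 * m ≤ BetaExpansion.phi y z ((i + 3 : ℕ) : ℝ) * m := by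
      nlinarith
    exact le_of_mul_le_mul_right this (by linarith)
  have h4 : (⌊BetaExpansion.phi y z m⌋₊ + 1 : ℕ) ≤ phiExponent y z i := by
    refine Nat.le_floor ?_
    rw [Nat.cast_add_one]
    have := Nat.floor_le hpos.le
    linarith
  omega

/-- The count is O(1 + log N), and log φ(q^(K+1)) is at most a power of log q, so any fixed power of
the count stays below q. -/
theorem eventually_suppCount_floor_pow_pow_le (y z : ℝ) {x : ℝ} (hx : 1 < x) (K B : ℕ) :
    ∀ᶠ q : ℕ in atTop, suppCount (onePlusSeries fun i => ⌊x ^ i⌋₊)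
      ⌊BetaExpansion.phi y z ((q ^ (K + 1) : ℕ) : ℝ)⌋₊ ^ B ≤ q := by
  obtain ⟨c₀, hc₀, hcount⟩ := exists_suppCount_floor_pow_le hx
  obtain ⟨c, hc⟩ := exists_log_phi_le y z
  have hq : Tendsto (fun q : ℕ => q ^ (K + 1)) atTop atTop := tendsto_pow_atTop (by omega)
  set c₁ : ℝ := c₀ * (2 + Real.log 2 + (K + 1) ^ c) with hc₁
  filter_upwards [hq.eventually hc, eventually_mul_log_pow_le (c₁ ^ B) (c * B),
    tendsto_natCast_atTop_atTop.eventually_ge_atTop (Real.exp 1)] with q h1 h2 h3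
  have hq0 : (0 : ℝ) < q := (Real.exp_pos 1).trans_le h3
  have hlog : 1 ≤ Real.log (q : ℝ) := (Real.le_log_iff_exp_le hq0).2 h3
  have hlog2 : 0 < Real.log 2 := Real.log_pos one_lt_two
  push_cast at h1 ⊢
  rw [Real.log_pow, mul_pow] at h1
  push_cast at h1
  set φ := BetaExpansion.phi y z ((q : ℝ) ^ (K + 1)) with hφ
  have hφ0 : 0 < φ := phi_pos _ _ _
  have h4 : Real.log ((⌊φ⌋₊ : ℝ) + 1) ≤
      1 + Real.log 2 + (K + 1) ^ c * Real.log q ^ c := by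
    by_cases hφ1 : φ < 1
    · rw [Nat.floor_eq_zero.2 hφ1]
      simp only [Nat.cast_zero, zero_add, Real.log_one]
      positivity
    · have : (⌊φ⌋₊ : ℝ) + 1 ≤ 2 * φ := by linarith [Nat.floor_le hφ0.le]
      have := Real.log_le_log (by positivity) this
      rw [Real.log_mul two_ne_zero hφ0.ne'] at this
      linarith
  have hlc : 1 ≤ Real.log (q : ℝ) ^ c := one_le_pow₀ hlog
  have h5 : (suppCount (onePlusSeries fun i => ⌊x ^ i⌋₊) ⌊φ⌋₊ : ℝ) ≤ c₁ * Real.log q ^ c := by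
    refine (hcount _).trans ?_
    rw [hc₁, mul_assoc]
    refine mul_le_mul_of_nonneg_left ?_ hc₀
    nlinarith
  have h6 : (suppCount (onePlusSeries fun i => ⌊x ^ i⌋₊) ⌊φ⌋₊ : ℝ) ^ B ≤ q := by
    calc _ ≤ (c₁ * Real.log q ^ c) ^ B := by gcongr
      _ = c₁ ^ B * Real.log q ^ (c * B) := by rw [mul_pow, pow_mul]
      _ ≤ q := h2
  exact_mod_cast h6

/-- Every large integer is well approximated from below by some `⌊φ(i)⌋`. -/
theorem eventually_exists_phiExponent_near {y z : ℝ} (h : (y, z) ∈ BetaExpansion.Theta)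
    (K A : ℕ) : ∀ᶠ q : ℕ in atTop,
      ∀ R ≤ ⌊BetaExpansion.phi y z ((q ^ (K + 3) : ℕ) : ℝ)⌋₊,
        ⌊BetaExpansion.phi y z ((q ^ (K + 3) : ℕ) : ℝ)⌋₊ ≤ R * q ^ A →
        ∃ i, phiExponent y z i ≤ R ∧ (R - phiExponent y z i) * q ^ (K + 1) ≤ R := by
  classical
  obtain ⟨c, hc⟩ := exists_phi_succ_le y z
  obtain ⟨i₁, hi₁⟩ := eventually_atTop.1 hc
  obtain ⟨M, hM1, hM⟩ := exists_phi_mul_pow_le h (A + 2)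
  obtain ⟨i₂, hi₂⟩ := eventually_atTop.1 (eventually_pow_le_phi h 2)
  filter_upwards [eventually_ge_atTop (i₁ + i₂ + M + 4),
    eventually_mul_log_pow_le (4 * ((K : ℝ) + 4) ^ c) c] with q hq hlogq
  intro R hRN hNR
  -- One factor q more than the wanted accuracy q^(K+1); it absorbs the power of log in the relative
  -- gaps of φ.
  set v := q ^ (K + 2) with hv
  have hqv : q ≤ v := Nat.le_self_pow (by omega) q
  have hm : q ^ (K + 3) = v * q := by rw [hv, ← pow_succ]
  rw [hm] at hRN hNR
  have hvm : v ≤ v * q := Nat.le_mul_of_pos_right _ (by omega)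
  have hq4 : (4 : ℝ) ≤ q := by exact_mod_cast (show 4 ≤ q by omega)
  have hv4 : (4 : ℝ) ≤ v := by exact_mod_cast (show 4 ≤ v by omega)
  set N := ⌊BetaExpansion.phi y z ((v * q : ℕ) : ℝ)⌋₊ with hN
  have hφm : BetaExpansion.phi y z ((v * q : ℕ) : ℝ) < N + 1 := Nat.lt_floor_add_one _
  have hN1 : 1 ≤ N := by
    refine Nat.le_floor ((?_ : _ ≤ _).trans (hi₂ (v * q) (by omega)))
    have : (1 : ℝ) ≤ ((v * q : ℕ) : ℝ) := by exact_mod_cast (show 1 ≤ v * q by omega)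
    rw [Nat.cast_one]
    exact one_le_pow₀ this
  -- As φ(vq) ≥ q^(A+2) φ(v), every R ≥ N/q^A exceeds φ(v). Hence the last i ≤ vq with φ(i) ≤ R
  -- satisfies i ≥ v.
  have hφv : BetaExpansion.phi y z v ≤ R := by
    have h1 := hM v (v * q) (by omega) hvm
    have h2 : (N : ℝ) ≤ R * (q : ℝ) ^ A := by exact_mod_cast hNR
    have h3 : (1 : ℝ) ≤ N := by exact_mod_cast hN1
    rw [Nat.cast_mul, mul_pow, ← Nat.cast_mul] at h1
    have h4 : BetaExpansion.phi y z v * (q : ℝ) ^ (A + 2) ≤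
        BetaExpansion.phi y z ((v * q : ℕ) : ℝ) := by
      refine le_of_mul_le_mul_right (le_trans (le_of_eq ?_) h1)
        (show (0 : ℝ) < (v : ℝ) ^ (A + 2) by positivity)
      ring
    have h5 : (2 : ℝ) * q ^ A ≤ q ^ (A + 2) := by
      rw [pow_add, mul_comm]
      gcongr
      nlinarith
    have h6 : BetaExpansion.phi y z v * (2 * (q : ℝ) ^ A) ≤ R * (2 * (q : ℝ) ^ A) := by
      have := mul_le_mul_of_nonneg_left h5 (phi_pos y z v).le
      nlinarith
    exact le_of_mul_le_mul_right h6 (by positivity)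
  set P : ℕ → Prop := fun i => BetaExpansion.phi y z i ≤ R with hP
  set i := Nat.findGreatest P (v * q) with hi
  have hPi : P i := Nat.findGreatest_spec hvm hφv
  have hvi : v ≤ i := Nat.le_findGreatest hvm hφv
  have him : i ≤ v * q := Nat.findGreatest_le _
  refine ⟨i - 3, ?_⟩
  have hexp : phiExponent y z (i - 3) = ⌊BetaExpansion.phi y z i⌋₊ := by
    rw [phiExponent, Nat.sub_add_cancel (by omega)]
  rw [hexp]
  have hφi := phi_pos y z i
  have hsR : ⌊BetaExpansion.phi y z i⌋₊ ≤ R := by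
    exact_mod_cast (Nat.floor_le hφi.le).trans hPi
  refine ⟨hsR, ?_⟩
  rcases him.eq_or_lt with heq | hlt
  · have : R - ⌊BetaExpansion.phi y z i⌋₊ = 0 := by
      rw [heq]
      omega
    rw [this]
    omega
  have hnot : (R : ℝ) < BetaExpansion.phi y z ((i + 1 : ℕ) : ℝ) := by
    have := Nat.findGreatest_is_greatest (P := P) (n := v * q) (k := i + 1) (by omega) (by omega)
    exact not_le.1 this
  have hi0 : (0 : ℝ) < i := by exact_mod_cast (show 0 < i by omega)
  have hvi' : (v : ℝ) ≤ i := by exact_mod_cast hvi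
  have hlogi : Real.log ((i + 1 : ℕ) : ℝ) ≤ (K + 4) * Real.log q := by
    have h1 : ((i + 1 : ℕ) : ℝ) ≤ (q : ℝ) ^ (K + 4) := by
      have h2 : i + 1 ≤ q ^ (K + 4) := by
        calc i + 1 ≤ q ^ (K + 3) := by omega
          _ ≤ q ^ (K + 4) := Nat.pow_le_pow_right (by omega) (by omega)
      exact_mod_cast h2
    have h3 := Real.log_le_log (by positivity) h1
    rw [Real.log_pow] at h3
    push_cast at h3 ⊢
    exact h3
  have hlog0 : 0 ≤ Real.log ((i + 1 : ℕ) : ℝ) := Real.log_natCast_nonneg _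
  set Λ := Real.log ((i + 1 : ℕ) : ℝ) ^ c with hΛ
  have hΛ0 : 0 ≤ Λ := pow_nonneg hlog0 c
  have hΛq : 4 * Λ ≤ q := by
    refine le_trans ?_ hlogq
    rw [mul_assoc, ← mul_pow]
    exact mul_le_mul_of_nonneg_left (pow_le_pow_left₀ hlog0 hlogi c) (by norm_num)
  have hqp : (v : ℝ) = q ^ (K + 1) * q := by
    rw [hv]
    push_cast
    ring
  set T : ℝ := (q : ℝ) ^ (K + 1) with hT
  have hT1 : 1 ≤ T := one_le_pow₀ (by linarith)
  have hδ : Λ / i * (4 * T) ≤ 1 := by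
    rw [div_mul_eq_mul_div, div_le_one hi0]
    calc Λ * (4 * T) = (4 * Λ) * T := by ring
      _ ≤ q * T := by gcongr
      _ = v := by rw [hqp]; ring
      _ ≤ i := hvi'
  have hδ0 : 0 ≤ Λ / i := by positivity
  have hδ1 : Λ / i ≤ 1 := by nlinarith
  have hexpδ : Real.exp (Λ / i) - 1 ≤ 2 * (Λ / i) := by
    have := Real.abs_exp_sub_one_le (x := Λ / i) (by rwa [abs_of_nonneg hδ0])
    rw [abs_of_nonneg hδ0] at this
    exact (le_abs_self _).trans this
  have hsucc := hi₁ i (by omega)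
  have hR0 : (0 : ℝ) ≤ R := Nat.cast_nonneg R
  -- The summand 1 is the cost of the floor.
  have hdiff : (R : ℝ) - ⌊BetaExpansion.phi y z i⌋₊ ≤ R * (2 * (Λ / i)) + 1 := by
    have h1 := Nat.lt_floor_add_one (BetaExpansion.phi y z i)
    have h2 : BetaExpansion.phi y z i * (Real.exp (Λ / i) - 1) ≤ R * (2 * (Λ / i)) :=
      mul_le_mul hPi hexpδ (by linarith [Real.one_le_exp hδ0]) hR0
    linarith
  have hR2 : 2 * T ≤ R := by
    have h1 := (hi₂ v (by omega)).trans hφv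
    refine le_trans ?_ h1
    rw [hqp]
    nlinarith
  have hfinal : ((R : ℝ) - ⌊BetaExpansion.phi y z i⌋₊) * T ≤ R := by
    calc ((R : ℝ) - ⌊BetaExpansion.phi y z i⌋₊) * T ≤ (R * (2 * (Λ / i)) + 1) * T := by gcongr
      _ = R * (Λ / i * (4 * T)) / 2 + T := by ring
      _ ≤ R * 1 / 2 + T := by gcongr
      _ ≤ R := by linarith
  rw [hT] at hfinal
  have : (((R - ⌊BetaExpansion.phi y z i⌋₊) * q ^ (K + 1) : ℕ) : ℝ) ≤ R := by
    push_cast [Nat.cast_sub hsR]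
    exact hfinal
  exact_mod_cast this

/-- The single scale N = ⌊φ(q^(K+3))⌋ meets all the demands at once. -/
theorem eventually_exists_scale {y z : ℝ} (h : (y, z) ∈ BetaExpansion.Theta) {x : ℝ} (hx : 1 < x)
    (K A B : ℕ) : ∀ᶠ q : ℕ in atTop, ∃ N,
      suppCount (onePlusSeries (phiExponent y z)) N ≤ 2 * q ^ (K + 3) ∧
      suppCount (onePlusSeries fun i => ⌊x ^ i⌋₊) N ^ B ≤ q ∧ q ^ A ≤ N ∧
      ∀ R ≤ N, N ≤ R * q ^ A → ∃ s ≤ R, 0 < coeff s (onePlusSeries (phiExponent y z)) ∧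
        (R - s) * q ^ (K + 1) ≤ R := by
  obtain ⟨M, hM⟩ := exists_le_mul_phiExponent h
  have hq : Tendsto (fun q : ℕ => q ^ (K + 3)) atTop atTop := tendsto_pow_atTop (by omega)
  filter_upwards [hq.eventually (eventually_suppCount_phiExponent_le h),
    eventually_suppCount_floor_pow_pow_le y z hx (K + 2) B,
    hq.eventually (eventually_pow_le_phi h A), eventually_exists_phiExponent_near h K A,
    eventually_ge_atTop 1] with q h1 h2 h3 h4 hq1
  refine ⟨_, h1, h2, Nat.le_floor (le_trans ?_ h3), fun R hR hN => ?_⟩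
  · exact_mod_cast Nat.pow_le_pow_left (Nat.le_self_pow (by omega) q) A
  · obtain ⟨i, hi1, hi2⟩ := h4 R hR hN
    exact ⟨_, hi1, coeff_onePlusSeries_pos (finite_fiber_of_le_mul hM) i, hi2⟩

/-! ### Algebraic independence -/

theorem evalAt_ne_zero_of_lex_leading {β : ℝ} (hint : IsIntegral ℤ β) (hβ : 1 < β)
    (hconj : ∀ w : ℂ, IsConjRoot ℚ (β : ℂ) w → w ≠ (β : ℂ) → ‖w‖ ≤ 1)
    (h0 : 0 < β⁻¹) (h1 : β⁻¹ < 1) {y z : ℝ} (hyz : (y, z) ∈ BetaExpansion.Theta) {x : ℝ}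
    (hx : 1 < x) (I : Finset (ℕ × ℕ)) (a : ℕ × ℕ → ℤ) {D E : ℕ} (htop : (D + 1, E + 1) ∈ I)
    (hpos : 0 < a (D + 1, E + 1))
    (hlex : ∀ p ∈ I, p ≠ (D + 1, E + 1) → p.1 ≤ D ∨ p.1 = D + 1 ∧ p.2 ≤ E) {h : polyGrowth}
    (hh : ∀ n, coeff n h.1 = ∑ p ∈ I, a p * coeff n
      (onePlusSeries (phiExponent y z) ^ p.1 * onePlusSeries (fun i => ⌊x ^ i⌋₊) ^ p.2)) :
    evalAt h0 h1 h ≠ 0 := by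
  intro heval
  obtain ⟨G₀, hG₀⟩ := exists_coeff_eq_zero_of_runs hint hβ hconj h0 h1 heval
  obtain ⟨M, hM⟩ := exists_le_mul_floor_pow hx
  obtain ⟨G, R, R', n, hG, hR', hRn, hnR', hz, hz', hnn, hne⟩ :=
    exists_coeff_ne_zero_between_runs (coeff_onePlusSeries_nonneg _)
      (coeff_zero_onePlusSeries_pos _) (coeff_onePlusSeries_nonneg _)
      (coeff_zero_onePlusSeries_pos _) (C := ⌈x⌉₊)
      (fun R hR => by
        obtain ⟨i, hi1, hi2⟩ := exists_floor_pow_mem_Icc hx hR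
        exact ⟨_, hi1, hi2, coeff_onePlusSeries_pos (finite_fiber_of_le_mul hM) i⟩)
      (eventually_exists_scale hyz hx) I a htop hpos hlex hh G₀
  exact hne (hG₀ G R R' hG (hRn.le.trans hnR') hR' hz hz' hnn n hRn hnR')

theorem algebraicIndependent_int_of_pisot_or_salem {β : ℝ} (hint : IsIntegral ℤ β) (hβ : 1 < β)
    (hconj : ∀ w : ℂ, IsConjRoot ℚ (β : ℂ) w → w ≠ (β : ℂ) → ‖w‖ ≤ 1)
    {y z : ℝ} (hyz : (y, z) ∈ BetaExpansion.Theta) {x : ℝ} (hx : 1 < x) :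
    AlgebraicIndependent ℤ ![1 + ∑' i, β⁻¹ ^ phiExponent y z i, 1 + ∑' i : ℕ, β⁻¹ ^ ⌊x ^ i⌋₊] := by
  classical
  have h0 : 0 < β⁻¹ := by positivity
  have h1 : β⁻¹ < 1 := inv_lt_one_of_one_lt₀ hβ
  obtain ⟨M, hM⟩ := exists_le_mul_phiExponent hyz
  obtain ⟨M', hM'⟩ := exists_le_mul_floor_pow hx
  have hf := onePlusSeries_mem_polyGrowth hM
  have hg := onePlusSeries_mem_polyGrowth hM'
  set F : Fin 2 → polyGrowth := ![⟨_, hf⟩, ⟨_, hg⟩] with hF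
  have hev : ![1 + ∑' i, β⁻¹ ^ phiExponent y z i, 1 + ∑' i : ℕ, β⁻¹ ^ ⌊x ^ i⌋₊] =
      (evalAt h0 h1).toIntAlgHom ∘ F := by
    funext i
    fin_cases i
    · exact (evalAt_onePlusSeries hf (finite_fiber_of_le_mul hM) h0 h1).symm
    · exact (evalAt_onePlusSeries hg (finite_fiber_of_le_mul hM') h0 h1).symm
  rw [hev, algebraicIndependent_iff]
  intro P hP
  by_contra hP0
  -- Multiplying by both variables keeps the relation and makes both exponents of the leading
  -- monomial positive, as the form (D+1, E+1) requires.
  set Q : MvPolynomial (Fin 2) ℤ := P * MvPolynomial.X 0 * MvPolynomial.X 1 with hQ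
  have hQ0 : Q ≠ 0 :=
    mul_ne_zero (mul_ne_zero hP0 (MvPolynomial.X_ne_zero 0)) (MvPolynomial.X_ne_zero 1)
  have hQev : evalAt h0 h1 (MvPolynomial.aeval F Q) = 0 := by
    have e : MvPolynomial.aeval ((evalAt h0 h1).toIntAlgHom ∘ F) Q =
        (evalAt h0 h1).toIntAlgHom (MvPolynomial.aeval F Q) := by
      rw [← AlgHom.comp_apply]
      congr 1
      ext i
      simp
    have e2 : MvPolynomial.aeval ((evalAt h0 h1).toIntAlgHom ∘ F) Q = 0 := by
      rw [hQ, map_mul, map_mul, hP, zero_mul, zero_mul]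
    exact e.symm.trans e2
  have hsupp : ∀ d ∈ Q.support, d 0 ≠ 0 ∧ d 1 ≠ 0 := by
    intro d hd
    rw [MvPolynomial.mem_support_iff] at hd
    constructor
    · have hQ' : Q = P * MvPolynomial.X 1 * MvPolynomial.X 0 := by rw [hQ]; ring
      rw [hQ', MvPolynomial.coeff_mul_X'] at hd
      exact Finsupp.mem_support_iff.1 (ite_ne_right_iff.1 hd).1
    · rw [hQ, MvPolynomial.coeff_mul_X'] at hd
      exact Finsupp.mem_support_iff.1 (ite_ne_right_iff.1 hd).1
  let e : (Fin 2 →₀ ℕ) ≃ ℕ × ℕ := Finsupp.equivFunOnFinite.trans (finTwoArrowEquiv ℕ)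
  have he : ∀ d, e d = (d 0, d 1) := fun d => rfl
  set I := Q.support.map e.toEmbedding with hI
  set a : ℕ × ℕ → ℤ := fun p => Q.coeff (e.symm p) with ha
  have hcoeff : ∀ n, coeff n (MvPolynomial.aeval F Q).1 = ∑ p ∈ I, a p * coeff n
      (onePlusSeries (phiExponent y z) ^ p.1 * onePlusSeries (fun i => ⌊x ^ i⌋₊) ^ p.2) := by
    intro n
    rw [MvPolynomial.aeval_def, MvPolynomial.eval₂_eq', hI, Finset.sum_map]
    have : ∀ s : Finset (Fin 2 →₀ ℕ), ∀ φ : (Fin 2 →₀ ℕ) → polyGrowth,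
        coeff n (∑ d ∈ s, φ d).1 = ∑ d ∈ s, coeff n (φ d).1 := by
      intro s φ
      rw [← map_sum]
      congr 1
      exact map_sum polyGrowth.subtype φ s
    rw [this]
    refine Finset.sum_congr rfl fun d _ => ?_
    simp only [ha, Equiv.coe_toEmbedding, Equiv.symm_apply_apply, Fin.prod_univ_two]
    rw [he]
    rw [Algebra.algebraMap_eq_smul_one, smul_mul_assoc, one_mul]
    change coeff n (Q.coeff d • (onePlusSeries (phiExponent y z) ^ d 0 *
      onePlusSeries (fun i => ⌊x ^ i⌋₊) ^ d 1)) = _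
    rw [map_smul, smul_eq_mul]
  have hIne : I.Nonempty := by
    rw [hI, Finset.map_nonempty]
    exact MvPolynomial.support_nonempty.2 hQ0
  obtain ⟨⟨D', E'⟩, htop, hmax⟩ := I.exists_max_image (fun p => toLex p) hIne
  have hItop : ∃ d ∈ Q.support, e d = (D', E') := by
    obtain ⟨d, hd, hde⟩ := Finset.mem_map.1 htop
    exact ⟨d, hd, hde⟩
  obtain ⟨d, hd, hde⟩ := hItop
  have hDE := hsupp d hd
  rw [he, Prod.mk.injEq] at hde
  rw [hde.1, hde.2] at hDE
  obtain ⟨D, rfl⟩ := Nat.exists_eq_add_one_of_ne_zero hDE.1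
  obtain ⟨E, rfl⟩ := Nat.exists_eq_add_one_of_ne_zero hDE.2
  have hlex : ∀ p ∈ I, p ≠ (D + 1, E + 1) → p.1 ≤ D ∨ p.1 = D + 1 ∧ p.2 ≤ E := by
    intro p hp hne
    have hle := hmax p hp
    rw [Prod.Lex.toLex_le_toLex] at hle
    rcases hle with hlt | ⟨heq, hle⟩
    · exact Or.inl (Nat.lt_succ_iff.1 hlt)
    · refine Or.inr ⟨heq, Nat.lt_succ_iff.1 (lt_of_le_of_ne hle fun h => hne ?_)⟩
      exact Prod.ext heq h
  have hatop : a (D + 1, E + 1) ≠ 0 := by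
    have : e.symm (D + 1, E + 1) = d := by
      rw [Equiv.symm_apply_eq, he, hde.1, hde.2]
    rw [ha]
    simp only [this]
    exact MvPolynomial.mem_support_iff.1 hd
  rcases lt_or_gt_of_ne hatop with hneg | hpos
  · refine evalAt_ne_zero_of_lex_leading hint hβ hconj h0 h1 hyz hx I (fun p => -a p) htop
      (neg_pos.2 hneg) hlex (h := -MvPolynomial.aeval F Q) (fun n => ?_) (by
        rw [map_neg, hQev, neg_zero])
    rw [Subring.coe_neg, map_neg, hcoeff, ← Finset.sum_neg_distrib]
    exact Finset.sum_congr rfl fun p _ => (neg_mul _ _).symm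
  · exact evalAt_ne_zero_of_lex_leading hint hβ hconj h0 h1 hyz hx I a htop hpos hlex hcoeff hQev

/-- The second sum of the theorem lacks the constant term 1 of its series; the substitution X₁ ↦ X₁
- 1 is an automorphism of the polynomial ring. -/
theorem AlgebraicIndependent.of_one_add {R A : Type*} [CommRing R] [CommRing A] [Algebra R A]
    {a b : A} (h : AlgebraicIndependent R ![a, 1 + b]) : AlgebraicIndependent R ![a, b] := by
  let S : MvPolynomial (Fin 2) R →ₐ[R] MvPolynomial (Fin 2) R :=
    MvPolynomial.aeval ![MvPolynomial.X 0, MvPolynomial.X 1 + 1]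
  let T : MvPolynomial (Fin 2) R →ₐ[R] MvPolynomial (Fin 2) R :=
    MvPolynomial.aeval ![MvPolynomial.X 0, MvPolynomial.X 1 - 1]
  have hST : S.comp T = AlgHom.id R _ := by
    refine MvPolynomial.algHom_ext fun i => ?_
    fin_cases i <;> simp [S, T]
  have hT : (MvPolynomial.aeval ![a, 1 + b]).comp T = MvPolynomial.aeval ![a, b] := by
    refine MvPolynomial.algHom_ext fun i => ?_
    fin_cases i <;> simp [T]
  have hinv : Function.LeftInverse S T := fun p => DFunLike.congr_fun hST p
  rw [algebraicIndependent_iff_injective_aeval] at h ⊢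
  rw [← hT, AlgHom.coe_comp]
  exact h.comp hinv.injective

theorem mainTheorem7 (y z : ℝ) (hyz : (y, z) ∈ BetaExpansion.Theta) (x : ℝ) (hx : 1 < x)
    (β : ℝ) (hβ : BetaExpansion.IsPisot β ∨ BetaExpansion.IsSalem β) :
    AlgebraicIndependent ℚ
      ![BetaExpansion.xi y z β⁻¹, ∑' m : ℕ, β ^ (-⌊x ^ m⌋)] := by
  obtain ⟨hint, hβ1, hconj⟩ : IsIntegral ℤ β ∧ 1 < β ∧
      ∀ w : ℂ, IsConjRoot ℚ (β : ℂ) w → w ≠ (β : ℂ) → ‖w‖ ≤ 1 := by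
    rcases hβ with ⟨h1, h2, h3⟩ | ⟨h1, h2, h3, -⟩
    · exact ⟨h1, h2, fun w hw hne => (h3 w hw hne).le⟩
    · exact ⟨h1, h2, h3⟩
  have hη : ∑' m : ℕ, β ^ (-⌊x ^ m⌋) = ∑' m : ℕ, β⁻¹ ^ ⌊x ^ m⌋₊ := by
    refine tsum_congr fun m => ?_
    rw [← Int.natCast_floor_eq_floor (by positivity), zpow_neg, zpow_natCast, inv_pow]
  rw [hη]
  have : Algebra.IsAlgebraic ℤ ℚ :=
    (IsFractionRing.comap_isAlgebraic_iff (A := ℤ) (K := ℚ) (C := ℚ)).2 inferInstance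
  have key := algebraicIndependent_int_of_pisot_or_salem hint hβ1 hconj hyz hx
  exact key.of_one_add.extendScalars ℚ
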